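/- Let $k\in\mathbb C$ with $\operatorname{Im}k>0$, let $\theta_{\rm I}\in\mathbb R$, and let $H^{(1)}_0$ be the Hankel function. Consider $\mathcal J$ semi-infinite arrays in the plane; the $n$-th scatterer ($n\ge 0$) of the $j$-th array is at $\mathbf R^{(j)}_n=R^{(j)}_0(\cos\theta^{(j)}_0,\sin\theta^{(j)}_0)+n s_j(\cos\alpha_j,\sin\alpha_j)$ and has radius $a_j$, where $s_j>0$ and $0<a_j<s_j/2$. Put $\Lambda^{(j,\ell)}(m,n)=|\mathbf R^{(j)}_m-\mathbf R^{(\ell)}_n|$ and assume $a_j+a_\ell<\Lambda^{(j,\ell)}(m,n)$ for all $j\neq\ell$ and $m,n\ge0$. Let $\mathbf k=-k(\cos\theta_{\rm I},\sin\theta_{\rm I})$, $z_j=e^{iks_j\cos(\alpha_j-\theta_{\rm I})}$, $\Omega_j^+=\{|z|<e^{-\operatorname{Im}(k)s_j\cos(\alpha_j-\theta_{\rm I})}\}$, $\Omega_j^-=\{|z|>e^{-\operatorname{Im}(k)s_j}\}$ and assume $\Omega_j^+\cap\Omega_j^-\ne\emptyset$ for all $j$. On the annulus $\mathcal A_j=\{e^{-\operatorname{Im}(k)s_j}<|z|<e^{\operatorname{Im}(k)s_j}\}$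 let $$K_j(z)=H^{(1)}_0(ka_j)+\sum_{\ell=1}^\infty(z^\ell+z^{-\ell})H^{(1)}_0(ks_j\ell).$$ (1) For given $k$ and $s_j$, the kernel $K_j$ has no zero in $\mathcal A_j$ if $a_j$ is sufficiently small. (2) If $K_j$ has no zero in $\mathcal A_j$, then it has an analytic logarithm there, and the formulae $$\ln K_j^+(z)=\ln K_j^0-\frac1{2\pi i}\int_C\frac{\ln K_j(\xi)}{\xi-1/z}\,d\xi,\quad \ln K_j^-(z)=\ln K_j^0-\frac1{2\pi i}\int_C\frac{\ln K_j(\xi)}{\xi-z}\,d\xi,\quad \ln K_j^0=\ln K_j^+(0)=\frac1{4\pi i}\int_C\frac{\ln K_j(\xi)}{\xi}\,d\xi,$$ where $C$ is any anticlockwise circle about $0$ in $\mathcal A_j$ of radius less than $1/|z|$, respectively $|z|$, define $K_j^+$ on $\{|z|<e^{\operatorname{Im}(k)s_j}\}$ and $K_j^-$ on $\Omega_j^-$. These functions are analytic and zero-free, $K_j^-(1/z)=K_j^+(z)$ for $0<|z|<e^{\operatorname{Im}(k)s_j}$, and $K_j=K_j^+K_j^-$ on $\mathcal A_j$. (3)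 Suppose that every $K_j$ has no zero in $\mathcal A_j$. Let $\lambda_{j,n}=\frac1{n!}\frac{d^n}{dz^n}\big[1/K_j^+(z)\big]_{z=0}$ and $$A^{(j)}_{0,m}=-\frac{e^{i\mathbf k\cdot\mathbf R^{(j)}_0}}{K_j^-(z_j)}\sum_{n=0}^m\lambda_{j,n}z_j^{n-m},\qquad \mathcal M^{(j,\ell)}_{mq}=\sum_{p=0}^\infty\sum_{n=0}^m\lambda_{j,m-n}\lambda_{j,p}H^{(1)}_0\big(k\Lambda^{(j,\ell)}(p+n,q)\big)\quad(\ell\ne j).$$ Then $\sum_m A^{(j)}_{0,m}z^m$ converges in $\Omega_j^+$, and $(A^{(j)}_{0,m})_m$ solves the Foldy system (below, with $\mathcal J=1$) of the $j$-th array alone; the series for $\mathcal M^{(j,\ell)}_{mq}$ converge absolutely. Moreover, let $A^{(j)}_m$ ($1\le j\le\mathcal J$, $m\ge0$) be coefficients whose Z-transforms $\sum_m A^{(j)}_mz^m$ converge in $\Omega_j^+$ and that satisfy, for all $j$ and all $m\ge0$, the coupled Foldy systems $$A^{(j)}_mH^{(1)}_0(ka_j)+\sum_{n\ge0,\,n\ne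 m}A^{(j)}_nH^{(1)}_0(ks_j|m-n|)=-e^{i\mathbf k\cdot\mathbf R^{(j)}_m}-\sum_{\ell\ne j}\sum_{n=0}^\infty A^{(\ell)}_nH^{(1)}_0\big(k\Lambda^{(j,\ell)}(m,n)\big).$$ Then for all $j$ and $m$ $$A^{(j)}_m=A^{(j)}_{0,m}-\sum_{\ell\ne j}\sum_{q=0}^\infty\sum_{p=0}^\infty\sum_{n=0}^m\lambda_{j,m-n}\lambda_{j,p}A^{(\ell)}_qH^{(1)}_0\big(k\Lambda^{(j,\ell)}(p+n,q)\big),$$ where the double series in $(q,p)$ converges absolutely. Equivalently, $\mathbf A^{(j)}=\mathbf A^{(j)}_0-\sum_{\ell\neq j}\mathcal M^{(j,\ell)}\mathbf A^{(\ell)}$ for all $j$, that is, the block system with identity diagonal blocks and off-diagonal blocks $\mathcal M^{(j,\ell)}$ maps $(\mathbf A^{(\ell)})_\ell$ to $(\mathbf A^{(j)}_0)_j$; all these series converge absolutely. -/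

import Mathlib

open Complex

namespace FoldyArrays

noncomputable section

/-- The Hankel function `H₀⁽¹⁾` on the upper half plane, by its classical integral representation
`H₀⁽¹⁾(w) = (π i)⁻¹ ∫_{-∞}^{∞} exp (i w cosh t) dt`, valid for `0 < Im w`. It is only ever evaluated
at `w = k x` with `0 < Im k` and `0 < x`. -/
def hankel (w : ℂ) : ℂ :=
  (Real.pi * I)⁻¹ * ∫ t : ℝ, exp (I * w * (Real.cosh t : ℂ))

/-- The parameters of a semi-infinite array: scatterer radius `a`, spacing `s`, angle `α` with the
`x`-axis, and polar coordinates `(R₀, θ₀)` of the first scatterer. -/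
structure SemiInfiniteArray where
  a : ℝ
  s : ℝ
  α : ℝ
  R₀ : ℝ
  θ₀ : ℝ

/-- Position of the `n`-th scatterer of an array. -/
def SemiInfiniteArray.pos (X : SemiInfiniteArray) (n : ℕ) : EuclideanSpace ℝ (Fin 2) :=
  !₂[X.R₀ * Real.cos X.θ₀ + n * X.s * Real.cos X.α,
     X.R₀ * Real.sin X.θ₀ + n * X.s * Real.sin X.α]

/-- The distance between the `m`-th scatterer of `X` and the `n`-th scatterer of `Y`. -/
def scattererDist (X Y : SemiInfiniteArray) (m n : ℕ) : ℝ :=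
  dist (X.pos m) (Y.pos n)

/-- The scatterers have positive radius and do not overlap. -/
structure Admissible {J : ℕ} (X : Fin J → SemiInfiniteArray) : Prop where
  radius_pos : ∀ j, 0 < (X j).a
  spacing_pos : ∀ j, 0 < (X j).s
  same_array : ∀ j, (X j).a < (X j).s / 2
  other_array : ∀ j l, j ≠ l → ∀ m n, (X j).a + (X l).a < scattererDist (X j) (X l) m n

/-- The incident plane wave `exp (i 𝐤 · r)`, with wavevector
`𝐤 = -k (cos θI, sin θI)`. -/
def incident (k : ℂ) (θI : ℝ) (r : EuclideanSpace ℝ (Fin 2)) : ℂ :=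
  exp (I * (-k * ((Real.cos θI * r 0 + Real.sin θI * r 1 : ℝ) : ℂ)))

/-- The coupled systems of Foldy equations for the scattering coefficients `A j m`. -/
def IsFoldySolution {J : ℕ} (k : ℂ) (θI : ℝ) (X : Fin J → SemiInfiniteArray)
    (A : Fin J → ℕ → ℂ) : Prop :=
  ∀ (j : Fin J) (m : ℕ),
    A j m * hankel (k * (X j).a)
      + ∑' n : ℕ, (if n = m then 0
          else A j n * hankel (k * ((X j).s * |(m : ℝ) - (n : ℝ)| : ℝ)))
    = - incident k θI ((X j).pos m)
      - ∑ l ∈ Finset.univ.erase j,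
          ∑' n : ℕ, A l n * hankel (k * scattererDist (X j) (X l) m n)

/-- The region `Ω⁺`. -/
def OmegaPlus (k : ℂ) (θI : ℝ) (X : SemiInfiniteArray) : Set ℂ :=
  {z | ‖z‖ < Real.exp (-(k.im * X.s * Real.cos (X.α - θI)))}

/-- The region `Ω⁻`; it depends on the array only through the spacing `s`. -/
def OmegaMinus (k : ℂ) (s : ℝ) : Set ℂ :=
  {z | Real.exp (-(k.im * s)) < ‖z‖}

/-- The Z-transform `∑ₘ Aₘ zᵐ` converges in `Ω⁺`. -/
def ZTransformConverges (k : ℂ) (θI : ℝ) (X : SemiInfiniteArray) (A : ℕ → ℂ) : Prop :=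
  ∀ z ∈ OmegaPlus k θI X, Summable fun m : ℕ => A m * z ^ m

/-- The annulus of convergence of the Wiener–Hopf kernel. -/
def kernelAnnulus (k : ℂ) (s : ℝ) : Set ℂ :=
  {z | Real.exp (-(k.im * s)) < ‖z‖ ∧ ‖z‖ < Real.exp (k.im * s)}

/-- The Wiener–Hopf kernel
`K(z) = H₀⁽¹⁾(k a) + ∑_{l ≥ 1} (z ^ l + z ^ (-l)) H₀⁽¹⁾(k s l)`. -/
def kernel (k : ℂ) (a s : ℝ) (z : ℂ) : ℂ :=
  hankel (k * a)
    + ∑' l : ℕ, (z ^ (l + 1) + z⁻¹ ^ (l + 1)) * hankel (k * (s * (l + 1) : ℝ))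

/-- The kernel has no zero in its annulus. -/
def KernelZeroFree (k : ℂ) (a s : ℝ) : Prop :=
  ∀ z ∈ kernelAnnulus k s, kernel k a s z ≠ 0

/-- `L` is an analytic branch of `ln K` on the annulus. -/
def IsKernelLog (k : ℂ) (a s : ℝ) (L : ℂ → ℂ) : Prop :=
  DifferentiableOn ℂ L (kernelAnnulus k s) ∧
    ∀ z ∈ kernelAnnulus k s, exp (L z) = kernel k a s z

/-- `ln K⁰ = (4π i)⁻¹ ∮_{|ξ| = ρ} L(ξ) / ξ dξ`. -/
def logK0 (L : ℂ → ℂ) (ρ : ℝ) : ℂ :=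
  (4 * Real.pi * I)⁻¹ * ∮ ξ in C(0, ρ), L ξ / ξ

/-- `Kp = K⁺` and `Km = K⁻` are the factors of the kernel given by Cauchy's integral formulae
applied to a branch `L` of `ln K`, over anticlockwise circles in the annulus that run
radially below the pole (`ξ = 1 / z` for `K⁺`, `ξ = z` for `K⁻`). In the formula for `K⁺`,
`1 / (ξ - 1 / z)` is written as `z / (z ξ - 1)`, which also covers `K⁺(0) = K⁰`. -/
def IsKernelFactorization (k : ℂ) (a s : ℝ) (Kp Km : ℂ → ℂ) : Prop :=
  ∃ L : ℂ → ℂ, IsKernelLog k a s L ∧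
    ∀ ρ : ℝ, Real.exp (-(k.im * s)) < ρ → ρ < Real.exp (k.im * s) →
      (∀ z : ℂ, ρ * ‖z‖ < 1 →
        Kp z = exp (logK0 L ρ
          - (2 * Real.pi * I)⁻¹ * ∮ ξ in C(0, ρ), L ξ * (z / (z * ξ - 1)))) ∧
      (∀ z : ℂ, ρ < ‖z‖ →
        Km z = exp (logK0 L ρ
          - (2 * Real.pi * I)⁻¹ * ∮ ξ in C(0, ρ), L ξ / (ξ - z)))

/-- The Taylor coefficients `λₙ` of `1 / K⁺` at `0`. -/
def lam (Kp : ℂ → ℂ) (n : ℕ) : ℂ :=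
  iteratedDeriv n (fun z => (Kp z)⁻¹) 0 / (n.factorial : ℂ)

/-- The pole `exp (i k s cos (α - θI))` of the forcing term. -/
def pole (k : ℂ) (θI : ℝ) (X : SemiInfiniteArray) : ℂ :=
  exp (I * k * (X.s * Real.cos (X.α - θI) : ℝ))

/-- The coefficients `A₀,ₘ` of the solution for the array `X` alone. -/
def singleArray (k : ℂ) (θI : ℝ) (X : SemiInfiniteArray) (Kp Km : ℂ → ℂ) (m : ℕ) : ℂ :=
  - (incident k θI (X.pos 0) / Km (pole k θI X))
    * ∑ n ∈ Finset.range (m + 1), lam Kp n * pole k θI X ^ ((n : ℤ) - (m : ℤ))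

/-- The `p`-th term of the entry `(m, q)` of the interaction matrix. -/
def interactionTerm (k : ℂ) (X Y : SemiInfiniteArray) (Kp : ℂ → ℂ) (m q p : ℕ) : ℂ :=
  ∑ n ∈ Finset.range (m + 1),
    lam Kp (m - n) * lam Kp p * hankel (k * scattererDist X Y (p + n) q)

/-- The infinite interaction matrix, describing the action of the array `Y` on the array `X`;
`Kp` is the factor `K⁺` of the kernel of `X`. -/
def interactionMatrix (k : ℂ) (X Y : SemiInfiniteArray) (Kp : ℂ → ℂ) : Matrix ℕ ℕ ℂ :=
  fun m q => ∑' p : ℕ, interactionTerm k X Y Kp m q p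

/-- The block matrix with identity blocks on the diagonal and the interaction matrices
off the diagonal. -/
def blockMatrix {J : ℕ} (k : ℂ) (X : Fin J → SemiInfiniteArray) (Kp : Fin J → ℂ → ℂ) :
    Matrix (Fin J × ℕ) (Fin J × ℕ) ℂ :=
  fun u v =>
    if u.1 = v.1 then (1 : Matrix ℕ ℕ ℂ) u.2 v.2
    else interactionMatrix k (X u.1) (X v.1) (Kp u.1) u.2 v.2

end

end FoldyArrays

namespace FoldyArrays

open MeasureTheory Set Metric

/-! ### The Hankel function -/

/-! The Foldy operator of one array is a Toeplitz operator on the half-line whose symbol is the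
kernel K, and the symmetry K(1/z) = K(z) drives the Wiener–Hopf argument.

Small scatterers: by the integral representation of the Hankel function, the lattice sum is an
integral of two geometric series q/(1 - q) with |q| < 1. Their real parts are bounded below
uniformly on the annulus, while Re ∫ exp(i k a cosh t) dt tends to infinity as a → 0
(`le_re_integral_exp_mul_cosh`), so the two cannot cancel.

Factorization: on a strip, K ∘ exp has an analytic logarithm. The symmetry makes it even, evenness
forces 2πi-periodicity, so it descends to the annulus (`exists_isKernelLog`). Cauchy's formula on
the annulus splits ln K into an outer and an inner integral, which ξ ↦ 1/ξ exchanges; hence K(z) =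
K⁺(z) K⁺(1/z).

Coupled systems: comparing Fourier coefficients on the unit circle, the factorization says that the
Foldy operator is an upper triangular Toeplitz operator after a lower triangular one, both built
from the Taylor coefficients of K⁺ (`foldyOperator_eq`). The coefficients λ of 1/K⁺ invert both.
Along an array the plane wave is a geometric sequence, hence an eigenvector of the upper inverse,
and this yields A₀; the fields of the other arrays yield the interaction matrices. Weights ρ
strictly between exp(-Im(k) s) and |pole| make the rearrangements for one array absolutely
convergent; between arrays the decay of the Hankel function beats the growth of A
(`summable_lam_mul_hankel`). -/

lemma sq_div_four_le_cosh (t : ℝ) : t ^ 2 / 4 ≤ Real.cosh t := by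
  rw [← Real.cosh_abs, Real.cosh_eq, ← sq_abs]
  have h1 := Real.quadratic_le_exp_of_nonneg (abs_nonneg t)
  have h2 := Real.exp_pos (-|t|)
  have h3 := abs_nonneg t
  linarith

lemma integrable_exp_neg_mul_cosh {c : ℝ} (hc : 0 < c) :
    Integrable fun t : ℝ => Real.exp (-(c * Real.cosh t)) := by
  refine (integrable_exp_neg_mul_sq (b := c / 4) (by positivity)).mono'
    (by fun_prop) (Filter.Eventually.of_forall fun t => ?_)
  rw [Real.norm_eq_abs, Real.abs_exp, Real.exp_le_exp]
  nlinarith [sq_div_four_le_cosh t]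

lemma norm_exp_mul_cosh (k : ℂ) (x t : ℝ) :
    ‖exp (I * (k * x) * (Real.cosh t : ℂ))‖ = Real.exp (-(k.im * x * Real.cosh t)) := by
  rw [norm_exp]
  congr 1
  simp only [mul_re, I_re, I_im, ofReal_re, ofReal_im, mul_im]
  ring

lemma integrable_exp_mul_cosh {k : ℂ} (hk : 0 < k.im) {x : ℝ} (hx : 0 < x) :
    Integrable fun t : ℝ => exp (I * (k * x) * (Real.cosh t : ℂ)) := by
  refine (integrable_exp_neg_mul_cosh (mul_pos hk hx)).mono' ?_
    (Filter.Eventually.of_forall fun t => (norm_exp_mul_cosh k x t).le)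
  exact (Continuous.aestronglyMeasurable (by fun_prop))

/-- Because (x - x₀)(cosh t - 1) ≥ 0, the factor exp(-κ x) can be pulled out and what remains is
integrable in t and independent of x. -/
lemma exp_neg_mul_cosh_le {κ x₀ x : ℝ} (hκ : 0 < κ) (hx : x₀ ≤ x) (t : ℝ) :
    Real.exp (-(κ * x * Real.cosh t))
      ≤ Real.exp (-(κ * x)) * (Real.exp (κ * x₀) * Real.exp (-(κ * x₀ * Real.cosh t))) := by
  rw [← Real.exp_add, ← Real.exp_add, Real.exp_le_exp]
  nlinarith [mul_nonneg (mul_nonneg hκ.le (sub_nonneg.2 hx)) (sub_nonneg.2 (Real.one_le_cosh t))]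

lemma integral_exp_neg_mul_cosh_le {κ x₀ x : ℝ} (hκ : 0 < κ) (hx₀ : 0 < x₀) (hx : x₀ ≤ x) :
    ∫ t : ℝ, Real.exp (-(κ * x * Real.cosh t))
      ≤ (Real.exp (κ * x₀) * ∫ t : ℝ, Real.exp (-(κ * x₀ * Real.cosh t)))
        * Real.exp (-(κ * x)) := by
  rw [mul_comm _ (Real.exp (-(κ * x))), ← integral_const_mul, ← integral_const_mul]
  refine integral_mono (integrable_exp_neg_mul_cosh (mul_pos hκ (hx₀.trans_le hx))) ?_
    (exp_neg_mul_cosh_le hκ hx)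
  exact ((integrable_exp_neg_mul_cosh (mul_pos hκ hx₀)).const_mul _).const_mul _

/-- Exponential decay of `x ↦ H₀⁽¹⁾(k x)` away from `0`. -/
lemma exists_norm_hankel_le {k : ℂ} (hk : 0 < k.im) {x₀ : ℝ} (hx₀ : 0 < x₀) :
    ∃ C : ℝ, 0 ≤ C ∧ ∀ x : ℝ, x₀ ≤ x → ‖hankel (k * x)‖ ≤ C * Real.exp (-(k.im * x)) := by
  refine ⟨‖((Real.pi : ℂ) * I)⁻¹‖
    * (Real.exp (k.im * x₀) * ∫ t : ℝ, Real.exp (-(k.im * x₀ * Real.cosh t))),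
    mul_nonneg (norm_nonneg _) (mul_nonneg (Real.exp_pos _).le
      (integral_nonneg fun _ => (Real.exp_pos _).le)), fun x hx => ?_⟩
  rw [hankel, norm_mul, mul_assoc]
  refine mul_le_mul_of_nonneg_left ?_ (norm_nonneg _)
  refine (norm_integral_le_integral_norm _).trans ?_
  simp only [norm_exp_mul_cosh]
  exact integral_exp_neg_mul_cosh_le hk hx₀ hx

/-! ### Small scatterers -/

/-- The Möbius map q/(1 - q) sends the disc of radius r < 1 to a disc with leftmost point -r/(1 +
r). Although q/(1 - q) blows up near q = 1, its real part stays bounded below. -/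
lemma neg_norm_le_re_div_one_sub {q : ℂ} (hq : ‖q‖ < 1) : -‖q‖ ≤ (q / (1 - q)).re := by
  have hne : 1 - q ≠ 0 := by
    intro h
    rw [sub_eq_zero] at h
    simp [← h] at hq
  have hpos : 0 < normSq (1 - q) := normSq_pos.2 hne
  have h1 : normSq (1 - q) = 1 - 2 * q.re + ‖q‖ ^ 2 := by
    rw [normSq_apply, ← normSq_eq_norm_sq, normSq_apply]
    simp
    ring
  have h2 : (q / (1 - q)).re = (q.re - ‖q‖ ^ 2) / normSq (1 - q) := by
    rw [div_re, ← normSq_eq_norm_sq, normSq_apply q, ← add_div]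
    simp
    ring
  rw [h2, le_div_iff₀ hpos, h1]
  have h3 := abs_le.1 (abs_re_le_norm q)
  have h4 := norm_nonneg q
  generalize ‖q‖ = r at *
  generalize q.re = x at *
  by_cases hr : 1 - 2 * r ≤ 0
  · nlinarith [mul_nonneg (neg_nonneg.2 hr) (sub_nonneg.2 h3.2),
      mul_nonneg (mul_nonneg h4 (sub_nonneg.2 hq.le)) (by linarith : 0 ≤ 2 - r)]
  · nlinarith [mul_nonneg (not_le.1 hr).le (by linarith : 0 ≤ x + r), pow_nonneg h4 3]

lemma re_exp_mul_cosh (k : ℂ) (x t : ℝ) :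
    (exp (I * (k * x) * (Real.cosh t : ℂ))).re
      = Real.exp (-(k.im * x * Real.cosh t)) * Real.cos (k.re * x * Real.cosh t) := by
  rw [exp_re]
  congr 2 <;> simp only [mul_re, I_re, I_im, ofReal_re, ofReal_im, mul_im] <;> ring

lemma cosh_le_exp {t : ℝ} (ht : 0 ≤ t) : Real.cosh t ≤ Real.exp t := by
  rw [Real.cosh_eq]
  have : Real.exp (-t) ≤ Real.exp t := Real.exp_le_exp.2 (by linarith)
  linarith

/-- `Re ∫ exp (i k a cosh t) dt` is at least of the order `-log (|k| a)` as `a → 0`. -/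
lemma le_re_integral_exp_mul_cosh {k : ℂ} (hk : 0 < k.im) {T : ℝ} (hT : 0 ≤ T) :
    2 * (Real.exp (-1) * Real.cos 1 * T - 2 * ‖k‖ / k.im)
      ≤ (∫ t : ℝ, exp (I * (k * (Real.exp (-T) / ‖k‖ : ℝ)) * (Real.cosh t : ℂ))).re := by
  have hk0 : 0 < ‖k‖ := norm_pos_iff.2 fun h => by simp [h] at hk
  set a : ℝ := Real.exp (-T) / ‖k‖ with ha_def
  have ha : 0 < a := div_pos (Real.exp_pos _) hk0
  have hka : ‖k‖ * a = Real.exp (-T) := by rw [ha_def]; field_simp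
  set f : ℝ → ℝ := fun t =>
    Real.exp (-(k.im * a * Real.cosh t)) * Real.cos (k.re * a * Real.cosh t) with hf
  have hint := integrable_exp_mul_cosh hk ha
  have hfint : Integrable f := by
    have := hint.re
    simpa only [re_exp_mul_cosh, RCLike.re_to_complex] using this
  have h1 : (∫ t : ℝ, exp (I * (k * a) * (Real.cosh t : ℂ))).re = ∫ t : ℝ, f |t| := by
    have := integral_re hint
    simp only [RCLike.re_to_complex, re_exp_mul_cosh] at this
    rw [← this]
    simp only [hf, Real.cosh_abs]
  -- Evenness in t gives the factor 2. The half-line is then cut at T, the point where |k| a exp(t)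
  -- = 1.
  rw [h1, integral_comp_abs]
  refine mul_le_mul_of_nonneg_left ?_ zero_le_two
  rw [← Ioc_union_Ioi_eq_Ioi hT, setIntegral_union (Ioc_disjoint_Ioi le_rfl) measurableSet_Ioi
    hfint.integrableOn hfint.integrableOn, sub_eq_add_neg]
  refine add_le_add ?_ ?_
  · have h2 : ∫ _ in Ioc 0 T, Real.exp (-1) * Real.cos 1 = Real.exp (-1) * Real.cos 1 * T := by
      simp [hT, mul_comm]
    rw [← h2]
    refine setIntegral_mono_on (integrableOn_const (by simp)) hfint.integrableOn
      measurableSet_Ioc fun t ht => ?_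
    have h3 : ‖k‖ * a * Real.cosh t ≤ 1 := by
      rw [hka]
      calc Real.exp (-T) * Real.cosh t ≤ Real.exp (-T) * Real.exp T :=
            mul_le_mul_of_nonneg_left ((cosh_le_exp ht.1.le).trans (Real.exp_le_exp.2 ht.2))
              (Real.exp_pos _).le
        _ = 1 := by rw [← Real.exp_add]; simp
    have hac : 0 < a * Real.cosh t := mul_pos ha (Real.cosh_pos t)
    refine mul_le_mul (Real.exp_le_exp.2 ?_) ?_ Real.cos_one_pos.le (Real.exp_pos _).le
    · have := mul_le_mul_of_nonneg_right ((le_abs_self _).trans (abs_im_le_norm k)) hac.le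
      linarith
    · have := mul_le_mul_of_nonneg_right (abs_re_le_norm k) hac.le
      rw [← Real.cos_abs (k.re * a * Real.cosh t)]
      have h4 : |k.re * a * Real.cosh t| ≤ 1 := by
        rw [mul_assoc, abs_mul, abs_of_pos hac]
        linarith
      exact Real.cos_le_cos_of_nonneg_of_le_pi (abs_nonneg _) (by linarith [Real.pi_gt_three]) h4
  -- Beyond T the integrand is at least -exp(-c (t - T)), since a cosh t ≥ exp(t - T) / (2 |k|); the
  -- tail costs at most 1/c.
  · set c : ℝ := k.im / (2 * ‖k‖) with hc
    have hc0 : 0 < c := by positivity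
    have h2 : -(2 * ‖k‖ / k.im) = ∫ t in Ioi T, -(Real.exp (c * T) * Real.exp (-c * t)) := by
      rw [integral_neg, integral_const_mul, integral_exp_mul_Ioi (by linarith), neg_div_neg_eq,
        ← mul_div_assoc, ← Real.exp_add]
      simp [hc]
    rw [h2]
    refine setIntegral_mono_on (((integrableOn_exp_mul_Ioi (by linarith) T).const_mul _).neg)
      hfint.integrableOn measurableSet_Ioi fun t ht => ?_
    have h3 : c * (t - T) ≤ k.im * a * Real.cosh t := by
      have h5 : a * Real.exp t / 2 ≤ a * Real.cosh t := by
        rw [Real.cosh_eq]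
        have := mul_pos ha (Real.exp_pos (-t))
        linarith
      have h6 : a * Real.exp t = Real.exp (t - T) / ‖k‖ := by
        rw [ha_def, sub_eq_add_neg, Real.exp_add]; ring
      have h7 : t - T ≤ Real.exp (t - T) := by linarith [Real.add_one_le_exp (t - T)]
      calc c * (t - T) ≤ c * Real.exp (t - T) := mul_le_mul_of_nonneg_left h7 hc0.le
        _ = k.im * (a * Real.exp t / 2) := by rw [h6, hc]; field_simp
        _ ≤ k.im * (a * Real.cosh t) := mul_le_mul_of_nonneg_left h5 hk.le
        _ = _ := by ring
    have h4 : Real.exp (-(k.im * a * Real.cosh t)) ≤ Real.exp (c * T) * Real.exp (-c * t) := by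
      rw [← Real.exp_add, Real.exp_le_exp]
      linarith
    have h5 := Real.neg_one_le_cos (k.re * a * Real.cosh t)
    have h6 := Real.exp_pos (-(k.im * a * Real.cosh t))
    simp only [hf]
    nlinarith

lemma kernelAnnulus_norm_pos {k : ℂ} {s : ℝ} {z : ℂ} (hz : z ∈ kernelAnnulus k s) : 0 < ‖z‖ :=
  (Real.exp_pos _).trans hz.1

lemma kernelAnnulus_ne_zero {k : ℂ} {s : ℝ} {z : ℂ} (hz : z ∈ kernelAnnulus k s) : z ≠ 0 :=
  norm_pos_iff.1 (kernelAnnulus_norm_pos hz)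

lemma inv_mem_kernelAnnulus {k : ℂ} {s : ℝ} {z : ℂ} (hz : z ∈ kernelAnnulus k s) :
    z⁻¹ ∈ kernelAnnulus k s := by
  have h0 := kernelAnnulus_norm_pos hz
  have h1 : Real.exp (-(k.im * s)) = (Real.exp (k.im * s))⁻¹ := Real.exp_neg _
  refine ⟨?_, ?_⟩
  · rw [h1, norm_inv]
    exact inv_strictAnti₀ h0 hz.2
  · have := inv_strictAnti₀ (Real.exp_pos _) hz.1
    rwa [h1, inv_inv, ← norm_inv] at this

lemma exists_norm_hankel_lattice_le {k : ℂ} (hk : 0 < k.im) {s : ℝ} (hs : 0 < s) :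
    ∃ C : ℝ, 0 ≤ C ∧ ∀ l : ℕ, ‖hankel (k * (s * (l + 1) : ℝ))‖
      ≤ C * Real.exp (-(k.im * s)) ^ (l + 1) := by
  obtain ⟨C, hC, h⟩ := exists_norm_hankel_le hk hs
  refine ⟨C, hC, fun l => (h _ ?_).trans_eq ?_⟩
  · nlinarith [(Nat.cast_nonneg l : (0 : ℝ) ≤ l)]
  · rw [← Real.exp_nat_mul]
    push_cast
    ring_nf

lemma summable_hankel_mul_pow {k : ℂ} (hk : 0 < k.im) {s : ℝ} (hs : 0 < s) {x : ℝ} (hx0 : 0 ≤ x)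
    (hx : x < Real.exp (k.im * s)) :
    Summable fun l : ℕ => ‖hankel (k * (s * (l + 1) : ℝ))‖ * x ^ (l + 1) := by
  obtain ⟨C, hC, h⟩ := exists_norm_hankel_lattice_le hk hs
  have h1 : Real.exp (-(k.im * s)) * x < 1 := by
    rw [Real.exp_neg, inv_mul_lt_iff₀ (Real.exp_pos _), mul_one]
    exact hx
  have h2 : Summable fun l : ℕ => C * (Real.exp (-(k.im * s)) * x) ^ (l + 1) :=
    ((summable_nat_add_iff 1).2 (summable_geometric_of_lt_one (by positivity) h1)).mul_left C
  refine h2.of_nonneg_of_le (fun l => by positivity) fun l => ?_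
  rw [mul_pow, ← mul_assoc]
  exact mul_le_mul_of_nonneg_right (h l) (by positivity)

/-- The lattice sum in the kernel is the integral of a geometric series. -/
lemma tsum_kernel_eq_integral {k : ℂ} (hk : 0 < k.im) {s : ℝ} (hs : 0 < s) {z : ℂ}
    (hz : z ∈ kernelAnnulus k s) :
    ∑' l : ℕ, (z ^ (l + 1) + z⁻¹ ^ (l + 1)) * hankel (k * (s * (l + 1) : ℝ))
      = (Real.pi * I)⁻¹ * ∫ t : ℝ, ∑' l : ℕ, (z ^ (l + 1) + z⁻¹ ^ (l + 1))
          * exp (I * (k * (s * (l + 1) : ℝ)) * (Real.cosh t : ℂ)) := by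
  have hz' := inv_mem_kernelAnnulus hz
  have hpos : ∀ l : ℕ, 0 < s * ((l : ℝ) + 1) := fun l => by positivity
  have key := hasSum_integral_of_summable_integral_norm
    (μ := (volume : Measure ℝ)) (F := fun (l : ℕ) (t : ℝ) => (z ^ (l + 1) + z⁻¹ ^ (l + 1))
          * exp (I * (k * (s * (l + 1) : ℝ)) * (Real.cosh t : ℂ)))
    (fun l => (integrable_exp_mul_cosh hk (hpos l)).const_mul _) ?_
  · rw [← key.tsum_eq, ← tsum_mul_left]
    refine tsum_congr fun l => ?_
    rw [integral_const_mul, hankel]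
    ring
  · set D := Real.exp (k.im * s) * ∫ t : ℝ, Real.exp (-(k.im * s * Real.cosh t)) with hD
    have hD0 : 0 ≤ D := mul_nonneg (Real.exp_pos _).le
      (integral_nonneg fun _ => (Real.exp_pos _).le)
    have hgeo : ∀ w ∈ kernelAnnulus k s,
        Summable fun l : ℕ => D * (Real.exp (-(k.im * s)) * ‖w‖) ^ (l + 1) := by
      intro w hw
      have h1 : Real.exp (-(k.im * s)) * ‖w‖ < 1 := by
        rw [Real.exp_neg, inv_mul_lt_iff₀ (Real.exp_pos _), mul_one]
        exact hw.2
      exact ((summable_nat_add_iff 1).2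
        (summable_geometric_of_lt_one (by positivity) h1)).mul_left D
    refine ((hgeo z hz).add (hgeo _ hz')).of_nonneg_of_le
      (fun l => integral_nonneg fun _ => norm_nonneg _) fun l => ?_
    simp only [norm_mul, norm_exp_mul_cosh]
    rw [integral_const_mul]
    have h2 := integral_exp_neg_mul_cosh_le hk hs
      (show s ≤ s * ((l : ℝ) + 1) by nlinarith [(Nat.cast_nonneg l : (0 : ℝ) ≤ l)])
    have h3 : Real.exp (-(k.im * (s * ((l : ℝ) + 1)))) = Real.exp (-(k.im * s)) ^ (l + 1) := by
      rw [← Real.exp_nat_mul]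
      push_cast
      ring_nf
    rw [h3, ← hD] at h2
    calc _ ≤ (‖z‖ ^ (l + 1) + ‖z⁻¹‖ ^ (l + 1)) * (D * Real.exp (-(k.im * s)) ^ (l + 1)) := by
          refine mul_le_mul ?_ h2 (integral_nonneg fun _ => (Real.exp_pos _).le) (by positivity)
          exact (norm_add_le _ _).trans_eq (by simp only [norm_pow])
      _ = _ := by rw [mul_pow, mul_pow]; ring

/-- With e = exp(i k s cosh t), both |z e| and |e / z| are below 1 and at most exp(Im(k) s (1 - cosh
t)) throughout the annulus. The bound is integrable in t and does not involve z. -/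
lemma re_tsum_geometric_ge {k : ℂ} (hk : 0 < k.im) {s : ℝ} (hs : 0 < s) {z : ℂ}
    (hz : z ∈ kernelAnnulus k s) (t : ℝ) :
    -(2 * (Real.exp (k.im * s) * Real.exp (-(k.im * s * Real.cosh t))))
      ≤ (∑' l : ℕ, (z ^ (l + 1) + z⁻¹ ^ (l + 1))
          * exp (I * (k * (s * (l + 1) : ℝ)) * (Real.cosh t : ℂ))).re := by
  set e := exp (I * (k * s) * (Real.cosh t : ℂ)) with he
  have hen : ‖e‖ = Real.exp (-(k.im * s * Real.cosh t)) := norm_exp_mul_cosh k s t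
  have hE : ∀ l : ℕ, exp (I * (k * (s * (l + 1) : ℝ)) * (Real.cosh t : ℂ)) = e ^ (l + 1) := by
    intro l
    rw [he, ← exp_nat_mul]
    push_cast
    ring_nf
  have hq : ∀ w ∈ kernelAnnulus k s,
      ‖w * e‖ ≤ Real.exp (k.im * s) * Real.exp (-(k.im * s * Real.cosh t)) ∧ ‖w * e‖ < 1 := by
    intro w hw
    rw [norm_mul, hen]
    refine ⟨mul_le_mul_of_nonneg_right hw.2.le (Real.exp_pos _).le, ?_⟩
    have h1 : Real.exp (-(k.im * s * Real.cosh t)) ≤ Real.exp (-(k.im * s)) := by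
      rw [Real.exp_le_exp]
      nlinarith [Real.one_le_cosh t, mul_pos hk hs]
    calc ‖w‖ * Real.exp (-(k.im * s * Real.cosh t)) ≤ ‖w‖ * Real.exp (-(k.im * s)) :=
          mul_le_mul_of_nonneg_left h1 (norm_nonneg _)
      _ < Real.exp (k.im * s) * Real.exp (-(k.im * s)) :=
          mul_lt_mul_of_pos_right hw.2 (Real.exp_pos _)
      _ = 1 := by rw [← Real.exp_add]; simp
  have hsum : ∀ w ∈ kernelAnnulus k s,
      HasSum (fun l : ℕ => (w * e) ^ (l + 1)) (w * e / (1 - w * e)) := by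
    intro w hw
    have := (hasSum_geometric_of_norm_lt_one (hq w hw).2).mul_left (w * e)
    simpa only [pow_succ', div_eq_mul_inv] using this
  have hz' := inv_mem_kernelAnnulus hz
  have htot := ((hsum z hz).add (hsum _ hz')).tsum_eq
  have hcongr : (∑' l : ℕ, (z ^ (l + 1) + z⁻¹ ^ (l + 1))
          * exp (I * (k * (s * (l + 1) : ℝ)) * (Real.cosh t : ℂ)))
      = ∑' l : ℕ, ((z * e) ^ (l + 1) + (z⁻¹ * e) ^ (l + 1)) :=
    tsum_congr fun l => by rw [hE, mul_pow, mul_pow, add_mul]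
  rw [hcongr, htot, add_re]
  have h1 := neg_norm_le_re_div_one_sub (hq z hz).2
  have h2 := neg_norm_le_re_div_one_sub (hq _ hz').2
  linarith [(hq z hz).1, (hq _ hz').1]

theorem kernelZeroFree_of_small {k : ℂ} (hk : 0 < k.im) {s : ℝ} (hs : 0 < s) :
    ∃ ε : ℝ, 0 < ε ∧ ∀ a : ℝ, 0 < a → a < ε → KernelZeroFree k a s := by
  have hk0 : 0 < ‖k‖ := norm_pos_iff.2 fun h => by simp [h] at hk
  set D : ℝ := ∫ t : ℝ, 2 * (Real.exp (k.im * s) * Real.exp (-(k.im * s * Real.cosh t))) with hD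
  have hDint : Integrable fun t : ℝ =>
      2 * (Real.exp (k.im * s) * Real.exp (-(k.im * s * Real.cosh t))) :=
    ((integrable_exp_neg_mul_cosh (mul_pos hk hs)).const_mul _).const_mul _
  have hD0 : 0 ≤ D := integral_nonneg fun t => by positivity
  have hc0 : 0 < Real.exp (-1) * Real.cos 1 := mul_pos (Real.exp_pos _) Real.cos_one_pos
  -- For T > M the logarithmic lower bound exceeds 2 D, and a < exp(-M) / |k| is the same as T =
  -- -log(|k| a) > M.
  set M : ℝ := (D + 2 * ‖k‖ / k.im) / (Real.exp (-1) * Real.cos 1) with hM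
  have hM0 : 0 ≤ M := by positivity
  refine ⟨Real.exp (-M) / ‖k‖, by positivity, fun a ha haε z hz hzero => ?_⟩
  have hka : 0 < ‖k‖ * a := mul_pos hk0 ha
  set T : ℝ := -Real.log (‖k‖ * a) with hT
  have hexpT : Real.exp (-T) / ‖k‖ = a := by
    rw [hT, neg_neg, Real.exp_log hka]
    field_simp
  have hMT : M < T := by
    rw [lt_div_iff₀ hk0] at haε
    have := Real.log_lt_log hka (by rwa [mul_comm] at haε)
    rw [Real.log_exp] at this
    linarith
  have h1 := le_re_integral_exp_mul_cosh hk (hM0.trans hMT.le)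
  rw [hexpT] at h1
  have h2 : -D ≤ (∫ t : ℝ, ∑' l : ℕ, (z ^ (l + 1) + z⁻¹ ^ (l + 1))
          * exp (I * (k * (s * (l + 1) : ℝ)) * (Real.cosh t : ℂ))).re := by
    -- Integrability need not be decided: otherwise the integral has the default value 0, and -D ≤
    -- 0.
    by_cases hi : Integrable fun t : ℝ => ∑' l : ℕ, (z ^ (l + 1) + z⁻¹ ^ (l + 1))
          * exp (I * (k * (s * (l + 1) : ℝ)) * (Real.cosh t : ℂ))
    · have h3 := integral_re hi
      simp only [RCLike.re_to_complex] at h3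
      rw [← h3, hD, ← integral_neg]
      exact integral_mono hDint.neg hi.re (re_tsum_geometric_ge hk hs hz)
    · rw [integral_undef hi, zero_re]
      linarith
  have h3 : D + 2 * ‖k‖ / k.im < Real.exp (-1) * Real.cos 1 * T := by
    rw [hM, div_lt_iff₀ hc0] at hMT
    linarith
  rw [kernel, tsum_kernel_eq_integral hk hs hz, hankel, ← mul_add] at hzero
  have h4 := (mul_eq_zero.1 hzero).resolve_left
    (inv_ne_zero (mul_ne_zero (by exact_mod_cast Real.pi_ne_zero) I_ne_zero))
  have h5 := congrArg re h4
  rw [add_re, zero_re] at h5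
  linarith

/-! ### Analyticity of the kernel -/

lemma kernel_inv (k : ℂ) (a s : ℝ) (z : ℂ) : kernel k a s z⁻¹ = kernel k a s z := by
  simp only [kernel, inv_inv, add_comm]

/-- The part `∑_{l ≥ 1} H₀⁽¹⁾(k s l) z ^ l` of the kernel. -/
noncomputable def latticeSeries (k : ℂ) (s : ℝ) (z : ℂ) : ℂ :=
  ∑' l : ℕ, hankel (k * (s * (l + 1) : ℝ)) * z ^ (l + 1)

lemma summable_latticeSeries {k : ℂ} (hk : 0 < k.im) {s : ℝ} (hs : 0 < s) {z : ℂ}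
    (hz : ‖z‖ < Real.exp (k.im * s)) :
    Summable fun l : ℕ => hankel (k * (s * (l + 1) : ℝ)) * z ^ (l + 1) := by
  refine Summable.of_norm ?_
  simpa only [norm_mul, norm_pow] using summable_hankel_mul_pow hk hs (norm_nonneg z) hz

lemma kernel_eq_latticeSeries {k : ℂ} (hk : 0 < k.im) (a : ℝ) {s : ℝ} (hs : 0 < s) {z : ℂ}
    (hz : z ∈ kernelAnnulus k s) :
    kernel k a s z = hankel (k * a) + (latticeSeries k s z + latticeSeries k s z⁻¹) := by
  rw [kernel, latticeSeries, latticeSeries, ← (summable_latticeSeries hk hs hz.2).tsum_add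
    (summable_latticeSeries hk hs (inv_mem_kernelAnnulus hz).2)]
  congr 1
  exact tsum_congr fun l => by ring

lemma differentiableAt_latticeSeries {k : ℂ} (hk : 0 < k.im) {s : ℝ} (hs : 0 < s) {z : ℂ}
    (hz : ‖z‖ < Real.exp (k.im * s)) : DifferentiableAt ℂ (latticeSeries k s) z := by
  obtain ⟨ρ, h1, h2⟩ := exists_between hz
  have hρ : 0 ≤ ρ := (norm_nonneg z).trans h1.le
  have h : DifferentiableOn ℂ (latticeSeries k s) (Metric.ball 0 ρ) := by
    refine differentiableOn_tsum_of_summable_norm (summable_hankel_mul_pow hk hs hρ h2)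
      (fun l => by fun_prop) Metric.isOpen_ball fun l w hw => ?_
    rw [norm_mul, norm_pow]
    gcongr
    exact (mem_ball_zero_iff.1 hw).le
  exact h.differentiableAt (Metric.isOpen_ball.mem_nhds (mem_ball_zero_iff.2 h1))

lemma isOpen_kernelAnnulus (k : ℂ) (s : ℝ) : IsOpen (kernelAnnulus k s) :=
  (isOpen_lt continuous_const continuous_norm).inter (isOpen_lt continuous_norm continuous_const)

lemma differentiableOn_kernel {k : ℂ} (hk : 0 < k.im) (a : ℝ) {s : ℝ} (hs : 0 < s) :
    DifferentiableOn ℂ (kernel k a s) (kernelAnnulus k s) := by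
  intro z hz
  have h : DifferentiableAt ℂ
      (fun z => hankel (k * a) + (latticeSeries k s z + latticeSeries k s z⁻¹)) z := by
    have h1 := differentiableAt_latticeSeries hk hs hz.2
    have h2 := (differentiableAt_latticeSeries hk hs (inv_mem_kernelAnnulus hz).2).comp z
      (differentiableAt_inv (kernelAnnulus_ne_zero hz))
    exact (h1.add h2).const_add _
  exact h.differentiableWithinAt.congr (fun w hw => kernel_eq_latticeSeries hk a hs hw)
    (kernel_eq_latticeSeries hk a hs hz)

/-! ### Analytic logarithms -/

/-- Differentiating exp(F - G) = 1 gives F' = G', so two analytic logarithms of one function differ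
by a constant. -/
lemma sub_eq_sub_of_exp_eq_exp {S : Set ℂ} (hS : IsOpen S) (hc : IsPreconnected S) {F G : ℂ → ℂ}
    (hF : DifferentiableOn ℂ F S) (hG : DifferentiableOn ℂ G S)
    (h : ∀ w ∈ S, exp (F w) = exp (G w)) {x y : ℂ} (hx : x ∈ S) (hy : y ∈ S) :
    F x - G x = F y - G y := by
  have hD : DifferentiableOn ℂ (fun w => F w - G w) S := hF.sub hG
  refine hS.is_const_of_deriv_eq_zero hc hD (fun w hw => ?_) hx hy
  have hd := (hD.differentiableAt (hS.mem_nhds hw)).hasDerivAt.cexp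
  have he : (fun w => exp (F w - G w)) =ᶠ[nhds w] fun _ => 1 := by
    filter_upwards [hS.mem_nhds hw] with v hv
    rw [exp_sub, h v hv, div_self (exp_ne_zero _)]
  have h0 := hd.unique ((hasDerivAt_const w (1 : ℂ)).congr_of_eventuallyEq he)
  simpa using h0

/-- A zero-free analytic function on a convex open set has an analytic logarithm. -/
lemma exists_log_of_convex {S : Set ℂ} (hS : IsOpen S) (hc : Convex ℝ S) {f : ℂ → ℂ}
    (hf : DifferentiableOn ℂ f S) (h0 : ∀ w ∈ S, f w ≠ 0) :
    ∃ G : ℂ → ℂ, DifferentiableOn ℂ G S ∧ ∀ w ∈ S, exp (G w) = f w := by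
  rcases S.eq_empty_or_nonempty with rfl | ⟨x, hx⟩
  · exact ⟨0, by simp [differentiableOn_empty], by simp⟩
  -- A primitive g of f'/f makes f exp(-g) constant; adding a logarithm of that constant corrects g.
  obtain ⟨g, hg⟩ := hc.exists_forall_hasDerivWithinAt ((hf.deriv hS).div hf h0)
  have hg' : ∀ w ∈ S, HasDerivAt g (deriv f w / f w) w := fun w hw =>
    (hg w hw).hasDerivAt (hS.mem_nhds hw)
  have hderiv : ∀ w ∈ S, HasDerivAt (fun w => f w * exp (-g w)) 0 w := by
    intro w hw
    have h1 := (hf.differentiableAt (hS.mem_nhds hw)).hasDerivAt.mul (hg' w hw).neg.cexp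
    refine h1.congr_deriv ?_
    have := h0 w hw
    field_simp
    ring
  have hconst : ∀ w ∈ S, f w * exp (-g w) = f x * exp (-g x) := fun w hw =>
    hS.is_const_of_deriv_eq_zero hc.isPreconnected
      (fun v hv => (hderiv v hv).differentiableAt.differentiableWithinAt)
      (fun v hv => (hderiv v hv).deriv) hw hx
  have hne : f x * exp (-g x) ≠ 0 := mul_ne_zero (h0 x hx) (exp_ne_zero _)
  refine ⟨fun w => g w + log (f x * exp (-g x)),
    fun w hw => ((hg' w hw).differentiableAt.add_const _).differentiableWithinAt, fun w hw => ?_⟩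
  rw [exp_add, exp_log hne, ← hconst w hw, exp_neg]
  field_simp [exp_ne_zero]

/-- The vertical strip covering an annulus under `exp`. -/
def strip (b : ℝ) : Set ℂ := {w | -b < w.re ∧ w.re < b}

lemma isOpen_strip (b : ℝ) : IsOpen (strip b) :=
  (isOpen_lt continuous_const continuous_re).inter (isOpen_lt continuous_re continuous_const)

lemma convex_strip (b : ℝ) : Convex ℝ (strip b) :=
  (convex_halfSpace_re_gt _).inter (convex_halfSpace_re_lt _)

lemma neg_mem_strip {b : ℝ} {w : ℂ} (hw : w ∈ strip b) : -w ∈ strip b :=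
  ⟨by rw [neg_re]; linarith [hw.2], by rw [neg_re]; linarith [hw.1]⟩

lemma zero_mem_strip {b : ℝ} (hb : 0 < b) : (0 : ℂ) ∈ strip b :=
  ⟨by simpa using hb, by simpa using hb⟩

lemma exp_mem_kernelAnnulus {k : ℂ} {s : ℝ} {w : ℂ} :
    exp w ∈ kernelAnnulus k s ↔ w ∈ strip (k.im * s) := by
  simp [kernelAnnulus, strip, norm_exp]

lemma log_mem_strip {k : ℂ} {s : ℝ} {z : ℂ} (hz : z ∈ kernelAnnulus k s) :
    log z ∈ strip (k.im * s) := by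
  rw [← exp_mem_kernelAnnulus, exp_log (kernelAnnulus_ne_zero hz)]
  exact hz

lemma differentiableOn_comp_exp {k : ℂ} {s : ℝ} {f : ℂ → ℂ}
    (hf : DifferentiableOn ℂ f (kernelAnnulus k s)) :
    DifferentiableOn ℂ (fun w => f (exp w)) (strip (k.im * s)) :=
  hf.comp differentiable_exp.differentiableOn fun _ hw => exp_mem_kernelAnnulus.2 hw

/-- The symmetry `K(1/z) = K(z)` gives the kernel winding number zero about the origin, so that it
has an analytic logarithm on the annulus. -/
theorem exists_isKernelLog {k : ℂ} (hk : 0 < k.im) {a s : ℝ} (hs : 0 < s)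
    (hK : KernelZeroFree k a s) : ∃ L : ℂ → ℂ, IsKernelLog k a s L := by
  have hb : 0 < k.im * s := mul_pos hk hs
  set S := strip (k.im * s) with hSdef
  have hSo : IsOpen S := isOpen_strip _
  have hSc : IsPreconnected S := (convex_strip _).isPreconnected
  obtain ⟨G, hG, hGe⟩ := exists_log_of_convex hSo (convex_strip _)
    (differentiableOn_comp_exp (differentiableOn_kernel hk a hs))
    (fun w hw => hK _ (exp_mem_kernelAnnulus.2 hw))
  have heven : ∀ w ∈ S, G (-w) = G w := by
    intro w hw
    have h1 : DifferentiableOn ℂ (fun w => G (-w)) S :=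
      hG.comp differentiable_neg.differentiableOn fun _ h => neg_mem_strip h
    have h2 := sub_eq_sub_of_exp_eq_exp hSo hSc h1 hG
      (fun v hv => by rw [hGe _ (neg_mem_strip hv), hGe _ hv, exp_neg, kernel_inv]) hw
      (zero_mem_strip hb)
    simpa [sub_eq_zero] using h2
  have hperiodic : ∀ n : ℤ, ∀ w ∈ S, G (w + n * (2 * Real.pi * I)) = G w := by
    intro n w hw
    have hmem : ∀ v ∈ S, v + n * (2 * Real.pi * I) ∈ S := by
      intro v hv
      simpa [hSdef, strip] using hv
    have h1 : DifferentiableOn ℂ (fun w => G (w + n * (2 * Real.pi * I))) S :=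
      hG.comp (by fun_prop) hmem
    -- The increment of G under translation by 2πin is constant. At -πin the translation is
    -- negation, so evenness shows that the constant is 0.
    have h3 : -(n * (Real.pi * I)) ∈ S := by
      simpa [hSdef, strip] using hb
    have h2 := sub_eq_sub_of_exp_eq_exp hSo hSc h1 hG
      (fun v hv => by
        rw [hGe _ (hmem v hv), hGe _ hv, exp_add, exp_int_mul_two_pi_mul_I, mul_one]) hw h3
    have h4 : -(n * (Real.pi * I)) + n * (2 * Real.pi * I) = -(-(n * (Real.pi * I))) := by ring
    rwa [h4, heven _ h3, sub_self, sub_eq_zero] at h2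
  refine ⟨fun z => G (log z), fun z hz => ?_, fun z hz => ?_⟩
  · have hAo := isOpen_kernelAnnulus k s
    refine DifferentiableAt.differentiableWithinAt ?_
    by_cases hsl : z ∈ slitPlane
    · exact (hG.differentiableAt (hSo.mem_nhds (log_mem_strip hz))).comp z
        (differentiableAt_log hsl)
    -- Off the slit plane `log` is replaced by log(-w) + πi, analytic near z; the two differ by
    -- multiples of 2πi, which G does not see.
    · have hneg : -z ∈ slitPlane :=
        (mem_slitPlane_or_neg_mem_slitPlane (kernelAnnulus_ne_zero hz)).resolve_left hsl
      have hexp : ∀ w ∈ kernelAnnulus k s, exp (log (-w) + Real.pi * I) = w := by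
        intro w hw
        rw [exp_add, exp_log (neg_ne_zero.2 (kernelAnnulus_ne_zero hw)), exp_pi_mul_I]
        ring
      have hmem : ∀ w ∈ kernelAnnulus k s, log (-w) + Real.pi * I ∈ S := by
        intro w hw
        rw [hSdef, ← exp_mem_kernelAnnulus, hexp w hw]
        exact hw
      have heq : (fun w => G (log w)) =ᶠ[nhds z] fun w => G (log (-w) + Real.pi * I) := by
        filter_upwards [hAo.mem_nhds hz] with w hw
        have h1 : exp (log w) = exp (log (-w) + Real.pi * I) := by
          rw [hexp w hw, exp_log (kernelAnnulus_ne_zero hw)]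
        obtain ⟨n, hn⟩ := exp_eq_exp_iff_exists_int.1 h1
        rw [hn, hperiodic n _ (hmem w hw)]
      refine DifferentiableAt.congr_of_eventuallyEq ?_ heq
      refine (hG.differentiableAt (hSo.mem_nhds (hmem z hz))).comp z ?_
      exact ((differentiableAt_log hneg).comp z differentiableAt_id.neg).add_const _
  · rw [hGe _ (log_mem_strip hz), exp_log (kernelAnnulus_ne_zero hz)]

/-- L(1/z) and L(z) are logarithms of the same function and agree at z = 1, the image of 0 in the
strip. -/
lemma IsKernelLog.inv_eq {k : ℂ} (hk : 0 < k.im) {a s : ℝ} (hs : 0 < s) {L : ℂ → ℂ}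
    (hL : IsKernelLog k a s L) {z : ℂ} (hz : z ∈ kernelAnnulus k s) : L z⁻¹ = L z := by
  have h1 := differentiableOn_comp_exp hL.1
  have h2 : DifferentiableOn ℂ (fun w => L (exp (-w))) (strip (k.im * s)) :=
    h1.comp differentiable_neg.differentiableOn fun _ h => neg_mem_strip h
  have h3 := sub_eq_sub_of_exp_eq_exp (isOpen_strip _) (convex_strip _).isPreconnected h2 h1
    (fun w hw => by
      rw [hL.2 _ (exp_mem_kernelAnnulus.2 hw),
        hL.2 _ (exp_mem_kernelAnnulus.2 (neg_mem_strip hw)), exp_neg, kernel_inv])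
    (log_mem_strip hz) (zero_mem_strip (mul_pos hk hs))
  simpa [sub_eq_zero, exp_neg, exp_log (kernelAnnulus_ne_zero hz)] using h3

/-! ### Circle integrals -/

lemma circleIntegral_eq_of_differentiableAt_annulus {F : ℂ → ℂ} {r₁ r₂ : ℝ} (h0 : 0 < r₁)
    (hle : r₁ ≤ r₂) (hF : ∀ z : ℂ, r₁ ≤ ‖z‖ → ‖z‖ ≤ r₂ → DifferentiableAt ℂ F z) :
    (∮ z in C(0, r₂), F z) = ∮ z in C(0, r₁), F z := by
  -- The deformation result carries a weight 1/z, so it is applied to z F(z).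
  have key := circleIntegral_sub_center_inv_smul_eq_of_differentiable_on_annulus_off_countable
    (c := 0) (f := fun z => z * F z) h0 hle countable_empty
    (fun z hz => by
      have h1 : ‖z‖ ≤ r₂ := mem_closedBall_zero_iff.1 hz.1
      have h2 : r₁ ≤ ‖z‖ := not_lt.1 fun h => hz.2 (mem_ball_zero_iff.2 h)
      exact (continuousAt_id.mul (hF z h2 h1).continuousAt).continuousWithinAt)
    (fun z hz => by
      have h1 : ‖z‖ < r₂ := mem_ball_zero_iff.1 hz.1.1
      have h2 : r₁ < ‖z‖ := not_le.1 fun h => hz.1.2 (mem_closedBall_zero_iff.2 h)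
      exact differentiableAt_id.mul (hF z h2.le h1.le))
  have hcongr : ∀ r : ℝ, 0 < r →
      (∮ z in C(0, r), (z - 0)⁻¹ • (z * F z)) = ∮ z in C(0, r), F z := by
    intro r hr
    refine circleIntegral.integral_congr hr.le fun z hz => ?_
    have hz0 : z ≠ 0 := by
      rintro rfl
      simp [hr.ne] at hz
    simp [hz0]
  rwa [hcongr _ h0, hcongr _ (h0.trans_le hle)] at key

/-- The change of variables `ξ = 1 / η` in a circle integral. -/
lemma circleIntegral_inv (F : ℂ → ℂ) {r : ℝ} (hr : 0 < r) :
    (∮ ξ in C(0, r⁻¹), F ξ) = ∮ η in C(0, r), (η ^ 2)⁻¹ * F η⁻¹ := by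
  set g : ℝ → ℂ := fun θ => deriv (circleMap 0 r⁻¹) θ • F (circleMap 0 r⁻¹ θ) with hg
  have hper : Function.Periodic g (2 * Real.pi) := by
    intro θ
    simp only [hg, deriv_circleMap, periodic_circleMap 0 r⁻¹ θ]
  have hinv : ∀ θ, (circleMap 0 r θ)⁻¹ = circleMap 0 r⁻¹ (-θ) := by
    intro θ
    rw [circleMap_zero, circleMap_zero, mul_inv, ← exp_neg]
    push_cast
    ring_nf
  -- Inversion reverses the orientation of the circle, which cancels the sign in dξ = -dη/η².
  have h1 : (∮ η in C(0, r), (η ^ 2)⁻¹ * F η⁻¹) = ∫ θ in (0 : ℝ)..2 * Real.pi, g (-θ) := by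
    rw [circleIntegral]
    refine intervalIntegral.integral_congr fun θ _ => ?_
    have hne : circleMap 0 r θ ≠ 0 := circleMap_ne_center hr.ne'
    simp only [hg, deriv_circleMap, ← hinv, smul_eq_mul]
    field_simp
  rw [h1, intervalIntegral.integral_comp_neg, circleIntegral]
  have h2 := hper.intervalIntegral_add_eq (-(2 * Real.pi)) 0
  simp only [neg_add_cancel, zero_add] at h2
  rw [neg_zero, h2]

/-! ### The factors of the kernel -/

lemma mem_kernelAnnulus_of_norm_eq {k : ℂ} {s ρ : ℝ} (h1 : Real.exp (-(k.im * s)) < ρ)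
    (h2 : ρ < Real.exp (k.im * s)) {z : ℂ} (hz : ‖z‖ = ρ) : z ∈ kernelAnnulus k s :=
  ⟨hz ▸ h1, hz ▸ h2⟩

lemma inv_bounds {k : ℂ} {s ρ : ℝ} (h1 : Real.exp (-(k.im * s)) < ρ)
    (h2 : ρ < Real.exp (k.im * s)) :
    Real.exp (-(k.im * s)) < ρ⁻¹ ∧ ρ⁻¹ < Real.exp (k.im * s) := by
  have hρ : 0 < ρ := (Real.exp_pos _).trans h1
  have := inv_mem_kernelAnnulus (k := k) (s := s) (z := (ρ : ℂ))
    (mem_kernelAnnulus_of_norm_eq h1 h2 (by simp [hρ.le]))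
  simpa [kernelAnnulus, abs_of_pos hρ] using this

/-- The exponent in the formula for `K⁺`. -/
noncomputable def logKp (L : ℂ → ℂ) (ρ : ℝ) (z : ℂ) : ℂ :=
  logK0 L ρ - (2 * Real.pi * I)⁻¹ * ∮ ξ in C(0, ρ), L ξ * (z / (z * ξ - 1))

section

variable {k : ℂ} {a s : ℝ} {L : ℂ → ℂ}

lemma IsKernelLog.differentiableAt (hL : IsKernelLog k a s L) {z : ℂ}
    (hz : z ∈ kernelAnnulus k s) : DifferentiableAt ℂ L z :=
  hL.1.differentiableAt ((isOpen_kernelAnnulus k s).mem_nhds hz)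

lemma IsKernelLog.circleIntegrable (hL : IsKernelLog k a s L) {ρ : ℝ}
    (h1 : Real.exp (-(k.im * s)) < ρ) (h2 : ρ < Real.exp (k.im * s)) :
    CircleIntegrable L 0 ρ := by
  have hρ : 0 < ρ := (Real.exp_pos _).trans h1
  refine ContinuousOn.circleIntegrable hρ.le fun z hz => ?_
  exact (hL.differentiableAt (mem_kernelAnnulus_of_norm_eq h1 h2
    (mem_sphere_zero_iff_norm.1 hz))).continuousAt.continuousWithinAt

lemma logK0_eq (hL : IsKernelLog k a s L) {ρ₁ ρ₂ : ℝ} (h1 : Real.exp (-(k.im * s)) < ρ₁)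
    (hle : ρ₁ ≤ ρ₂) (h2 : ρ₂ < Real.exp (k.im * s)) : logK0 L ρ₂ = logK0 L ρ₁ := by
  have hρ : 0 < ρ₁ := (Real.exp_pos _).trans h1
  rw [logK0, logK0, circleIntegral_eq_of_differentiableAt_annulus hρ hle]
  intro z hz1 hz2
  exact (hL.differentiableAt ⟨h1.trans_le hz1, hz2.trans_lt h2⟩).div differentiableAt_id
    (norm_pos_iff.1 (hρ.trans_le hz1))

lemma logK0_inv (hk : 0 < k.im) (hs : 0 < s) (hL : IsKernelLog k a s L) {ρ : ℝ}
    (h1 : Real.exp (-(k.im * s)) < ρ) (h2 : ρ < Real.exp (k.im * s)) :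
    logK0 L ρ⁻¹ = logK0 L ρ := by
  have hρ : 0 < ρ := (Real.exp_pos _).trans h1
  rw [logK0, logK0, circleIntegral_inv _ hρ]
  congr 1
  refine circleIntegral.integral_congr hρ.le fun z hz => ?_
  have hz' := mem_kernelAnnulus_of_norm_eq h1 h2 (mem_sphere_zero_iff_norm.1 hz)
  have := kernelAnnulus_ne_zero hz'
  simp only [hL.inv_eq hk hs hz']
  field_simp

lemma mul_sub_one_ne_zero {z ξ : ℂ} (h : ‖ξ‖ * ‖z‖ < 1) : z * ξ - 1 ≠ 0 := by
  intro h0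
  have h1 := congrArg norm (sub_eq_zero.1 h0)
  rw [norm_mul, norm_one, mul_comm] at h1
  linarith

lemma logKp_eq (hL : IsKernelLog k a s L) {ρ₁ ρ₂ : ℝ} (h1 : Real.exp (-(k.im * s)) < ρ₁)
    (hle : ρ₁ ≤ ρ₂) (h2 : ρ₂ < Real.exp (k.im * s)) {z : ℂ} (hz : ρ₂ * ‖z‖ < 1) :
    logKp L ρ₂ z = logKp L ρ₁ z := by
  have hρ : 0 < ρ₁ := (Real.exp_pos _).trans h1
  rw [logKp, logKp, logK0_eq hL h1 hle h2, circleIntegral_eq_of_differentiableAt_annulus hρ hle]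
  intro ξ hξ1 hξ2
  have hne := mul_sub_one_ne_zero (z := z) (ξ := ξ)
    ((mul_le_mul_of_nonneg_right hξ2 (norm_nonneg z)).trans_lt hz)
  have := hL.differentiableAt ⟨h1.trans_le hξ1, hξ2.trans_lt h2⟩
  fun_prop (disch := exact hne)

/-- `ln K⁺` as a Cauchy integral over a circle around `z`. -/
lemma logKp_inv (hk : 0 < k.im) (hs : 0 < s) (hL : IsKernelLog k a s L) {ρ : ℝ}
    (h1 : Real.exp (-(k.im * s)) < ρ) (h2 : ρ < Real.exp (k.im * s)) {z : ℂ} (hz : ‖z‖ < ρ) :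
    logKp L ρ⁻¹ z
      = (2 * Real.pi * I)⁻¹ * (∮ η in C(0, ρ), (η - z)⁻¹ * L η) - logK0 L ρ := by
  have hρ : 0 < ρ := (Real.exp_pos _).trans h1
  have hcont : ContinuousOn L (sphere 0 ρ) := fun w hw =>
    (hL.differentiableAt (mem_kernelAnnulus_of_norm_eq h1 h2
      (mem_sphere_zero_iff_norm.1 hw))).continuousAt.continuousWithinAt
  have hsub : ∀ η ∈ sphere (0 : ℂ) ρ, η - z ≠ 0 := by
    intro η hη h0
    rw [sub_eq_zero.1 h0, mem_sphere_zero_iff_norm] at hη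
    linarith
  have hne0 : ∀ η ∈ sphere (0 : ℂ) ρ, η ≠ 0 := fun η hη =>
    norm_pos_iff.1 (by rw [mem_sphere_zero_iff_norm.1 hη]; exact hρ)
  have hi1 : CircleIntegrable (fun η => L η / η) 0 ρ :=
    ContinuousOn.circleIntegrable hρ.le (hcont.div continuousOn_id hne0)
  have hi2 : CircleIntegrable (fun η => (η - z)⁻¹ * L η) 0 ρ :=
    ContinuousOn.circleIntegrable hρ.le
      (((continuousOn_id.sub continuousOn_const).inv₀ hsub).mul hcont)
  -- After ξ = 1/η the integrand splits by partial fractions, z / (η (z - η)) = 1/η - 1/(η - z). The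
  -- 1/η part equals 2 ln K⁰ up to the factor 2πi, hence the final -ln K⁰.
  have hsplit : (∮ ξ in C(0, ρ⁻¹), L ξ * (z / (z * ξ - 1)))
      = (∮ η in C(0, ρ), L η / η) - ∮ η in C(0, ρ), (η - z)⁻¹ * L η := by
    rw [circleIntegral_inv _ hρ, ← circleIntegral.integral_sub hi1 hi2]
    refine circleIntegral.integral_congr hρ.le fun η hη => ?_
    have hη0 := hne0 η hη
    have hηz := hsub η hη
    have hzη : z - η ≠ 0 := fun h => hηz (by linear_combination -h)
    have h3 : z * η⁻¹ - 1 = (z - η) / η := by field_simp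
    simp only [hL.inv_eq hk hs (mem_kernelAnnulus_of_norm_eq h1 h2
      (mem_sphere_zero_iff_norm.1 hη)), h3]
    field_simp
    ring
  rw [logKp, hsplit, logK0_inv hk hs hL h1 h2, logK0]
  have hpi : (Real.pi : ℂ) ≠ 0 := by exact_mod_cast Real.pi_ne_zero
  have hI := I_ne_zero
  field_simp
  ring

/-- Cauchy's integral formula on an annulus. -/
lemma cauchy_annulus (hL : IsKernelLog k a s L) {ρ₁ ρ₂ : ℝ} (h1 : Real.exp (-(k.im * s)) < ρ₁)
    (h2 : ρ₂ < Real.exp (k.im * s)) {z : ℂ} (hz1 : ρ₁ < ‖z‖) (hz2 : ‖z‖ < ρ₂) :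
    (2 * Real.pi * I)⁻¹ * (∮ η in C(0, ρ₂), (η - z)⁻¹ * L η)
      - (2 * Real.pi * I)⁻¹ * (∮ η in C(0, ρ₁), (η - z)⁻¹ * L η) = L z := by
  have hρ : 0 < ρ₁ := (Real.exp_pos _).trans h1
  have hle : ρ₁ ≤ ρ₂ := (hz1.trans hz2).le
  have hAo := isOpen_kernelAnnulus k s
  have hz : z ∈ kernelAnnulus k s := ⟨h1.trans hz1, hz2.trans h2⟩
  -- The difference quotient is analytic across z, so its integrals over both circles agree; ∮ dw/(w
  -- - z) is 2πi over the outer circle and 0 over the inner one.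
  have hds : DifferentiableOn ℂ (dslope L z) (kernelAnnulus k s) :=
    (differentiableOn_dslope (hAo.mem_nhds hz)).2 hL.1
  have hinv := circleIntegral_eq_of_differentiableAt_annulus (F := dslope L z) hρ hle
    fun w hw1 hw2 => hds.differentiableAt (hAo.mem_nhds ⟨h1.trans_le hw1, hw2.trans_lt h2⟩)
  have hformula : ∀ ρ, Real.exp (-(k.im * s)) < ρ → ρ < Real.exp (k.im * s) → ‖z‖ ≠ ρ →
      (∮ w in C(0, ρ), dslope L z w)
        = (∮ w in C(0, ρ), (w - z)⁻¹ * L w) - (∮ w in C(0, ρ), (w - z)⁻¹) * L z := by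
    intro ρ hρ1 hρ2 hzρ
    have hρ0 : 0 < ρ := (Real.exp_pos _).trans hρ1
    have hsub : ∀ w ∈ sphere (0 : ℂ) ρ, w - z ≠ 0 := by
      intro w hw h0
      rw [sub_eq_zero.1 h0, mem_sphere_zero_iff_norm] at hw
      exact hzρ hw
    have hc1 : ContinuousOn (fun w => (w - z)⁻¹) (sphere 0 ρ) :=
      (continuousOn_id.sub continuousOn_const).inv₀ hsub
    have hcont : ContinuousOn L (sphere 0 ρ) := fun w hw =>
      (hL.differentiableAt (mem_kernelAnnulus_of_norm_eq hρ1 hρ2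
        (mem_sphere_zero_iff_norm.1 hw))).continuousAt.continuousWithinAt
    have h3 : (∮ w in C(0, ρ), (w - z)⁻¹) * L z = ∮ w in C(0, ρ), (w - z)⁻¹ * L z := by
      have := circleIntegral.integral_smul_const (fun w => (w - z)⁻¹) (L z) 0 ρ
      simpa only [smul_eq_mul] using this.symm
    have hi1 : CircleIntegrable (fun w => (w - z)⁻¹ * L w) 0 ρ :=
      (hc1.mul hcont).circleIntegrable hρ0.le
    have hi2 : CircleIntegrable (fun w => (w - z)⁻¹ * L z) 0 ρ :=
      (hc1.mul continuousOn_const).circleIntegrable hρ0.le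
    rw [h3, ← circleIntegral.integral_sub hi1 hi2]
    refine circleIntegral.integral_congr hρ0.le fun w hw => ?_
    have hne : w ≠ z := sub_ne_zero.1 (hsub w hw)
    simp only [dslope_of_ne _ hne, slope_def_field]
    rw [div_eq_inv_mul, mul_sub]
  have hout : (∮ w in C(0, ρ₂), (w - z)⁻¹) = 2 * Real.pi * I :=
    circleIntegral.integral_sub_inv_of_mem_ball (mem_ball_zero_iff.2 hz2)
  have hin : (∮ w in C(0, ρ₁), (w - z)⁻¹) = 0 := by
    have hd : ∀ w ∈ closedBall (0 : ℂ) ρ₁, DifferentiableAt ℂ (fun w => (w - z)⁻¹) w := by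
      intro w hw
      have hne : w - z ≠ 0 := by
        intro h0
        rw [sub_eq_zero.1 h0, mem_closedBall_zero_iff] at hw
        linarith
      fun_prop (disch := exact hne)
    refine circleIntegral_eq_zero_of_differentiable_on_off_countable hρ.le countable_empty
      (fun w hw => (hd w hw).continuousAt.continuousWithinAt)
      fun w hw => hd w (ball_subset_closedBall hw.1)
  rw [hformula ρ₂ (h1.trans_le hle) h2 hz2.ne, hformula ρ₁ h1 (hle.trans_lt h2) hz1.ne',
    hout, hin] at hinv
  have hpi : (2 * Real.pi * I : ℂ) ≠ 0 := two_pi_I_ne_zero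
  rw [← mul_sub, inv_mul_eq_iff_eq_mul₀ hpi]
  linear_combination hinv

/-- The Cauchy kernel of K⁺ at 1/z is that of K⁻ at z; this is the source of K⁻(z) = K⁺(1/z). -/
lemma mul_div_mul_sub_one_inv (z ξ : ℂ) (hz : z ≠ 0) :
    z⁻¹ / (z⁻¹ * ξ - 1) = (ξ - z)⁻¹ := by
  have : z⁻¹ * ξ - 1 = z⁻¹ * (ξ - z) := by field_simp
  rw [this, div_mul_eq_div_div, div_self (inv_ne_zero hz), one_div]

theorem exists_isKernelFactorization (hk : 0 < k.im) (hs : 0 < s)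
    (hK : KernelZeroFree k a s) : ∃ Kp Km : ℂ → ℂ, IsKernelFactorization k a s Kp Km := by
  classical
  obtain ⟨L, hL⟩ := exists_isKernelLog hk hs hK
  let P : ℂ → ℝ → Prop := fun z ρ =>
    Real.exp (-(k.im * s)) < ρ ∧ ρ < Real.exp (k.im * s) ∧ ρ * ‖z‖ < 1
  let Kp : ℂ → ℂ := fun z => if h : ∃ ρ, P z ρ then exp (logKp L h.choose z) else 1
  have hKp : ∀ z ρ, P z ρ → Kp z = exp (logKp L ρ z) := by
    intro z ρ hρ
    have h : ∃ ρ, P z ρ := ⟨ρ, hρ⟩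
    simp only [Kp, dif_pos h]
    have hc := h.choose_spec
    rcases le_total h.choose ρ with hle | hle
    · rw [logKp_eq hL hc.1 hle hρ.2.1 hρ.2.2]
    · rw [logKp_eq hL hρ.1 hle hc.2.1 hc.2.2]
  refine ⟨Kp, fun z => Kp z⁻¹, L, hL, fun ρ h1 h2 => ⟨fun z hz => hKp z ρ ⟨h1, h2, hz⟩,
    fun z hz => ?_⟩⟩
  have hρ : 0 < ρ := (Real.exp_pos _).trans h1
  have hz0 : 0 < ‖z‖ := hρ.trans hz
  change Kp z⁻¹ = _
  rw [hKp z⁻¹ ρ ⟨h1, h2, by rw [norm_inv, ← div_eq_mul_inv, div_lt_one hz0]; exact hz⟩, logKp]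
  simp only [mul_div_mul_sub_one_inv z _ (norm_pos_iff.1 hz0), div_eq_mul_inv]

end

section

variable {k : ℂ} {a s : ℝ} {Kp Km : ℂ → ℂ}

/-- On a disc of radius ρ reaching past z, inversion writes ln K⁺ as a Cauchy integral over |η| = ρ,
which has a power series there. -/
lemma IsKernelFactorization.differentiableOn_Kp (hk : 0 < k.im) (hs : 0 < s)
    (h : IsKernelFactorization k a s Kp Km) :
    DifferentiableOn ℂ Kp {z | ‖z‖ < Real.exp (k.im * s)} := by
  obtain ⟨L, hL, h⟩ := h
  intro z hz
  obtain ⟨ρ, hρz, hρ2⟩ := exists_between (max_lt (show ‖z‖ < _ from hz)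
    (Real.exp_lt_exp.2 (show -(k.im * s) < k.im * s by linarith [mul_pos hk hs])))
  have hρ1 : Real.exp (-(k.im * s)) < ρ := (le_max_right _ _).trans_lt hρz
  have hρ0 : 0 < ρ := (Real.exp_pos _).trans hρ1
  have heq : ∀ w ∈ ball (0 : ℂ) ρ, Kp w
      = exp ((2 * Real.pi * I)⁻¹ * (∮ η in C(0, ρ), (η - w)⁻¹ * L η) - logK0 L ρ) := by
    intro w hw
    rw [mem_ball_zero_iff] at hw
    rw [← logKp_inv hk hs hL hρ1 hρ2 hw]
    have hb := inv_bounds hρ1 hρ2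
    exact (h ρ⁻¹ hb.1 hb.2).1 w (by rw [inv_mul_lt_iff₀ hρ0, mul_one]; exact hw)
  obtain ⟨r, rfl⟩ : ∃ r : NNReal, (r : ℝ) = ρ := ⟨⟨ρ, hρ0.le⟩, rfl⟩
  have hps := hasFPowerSeriesOn_cauchy_integral (hL.circleIntegrable hρ1 hρ2)
    (NNReal.coe_pos.1 hρ0)
  have hd : DifferentiableOn ℂ
      (fun w => (2 * Real.pi * I)⁻¹ * (∮ η in C(0, r), (η - w)⁻¹ * L η)) (ball 0 r) := by
    have := hps.differentiableOn
    rw [Metric.eball_coe] at this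
    exact this
  have hd2 : DifferentiableOn ℂ Kp (ball 0 r) :=
    (hd.sub_const _).cexp.congr heq
  exact (hd2.differentiableAt (isOpen_ball.mem_nhds
    (mem_ball_zero_iff.2 ((le_max_left _ _).trans_lt hρz)))).differentiableWithinAt

lemma exists_radius_lt (hk : 0 < k.im) (hs : 0 < s) {z : ℂ} (hz : ‖z‖ < Real.exp (k.im * s)) :
    ∃ ρ : ℝ, Real.exp (-(k.im * s)) < ρ ∧ ρ < Real.exp (k.im * s) ∧ ρ * ‖z‖ < 1 := by
  obtain ⟨ρ, hρz, hρ2⟩ := exists_between (max_lt hz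
    (Real.exp_lt_exp.2 (show -(k.im * s) < k.im * s by linarith [mul_pos hk hs])))
  have hρ1 : Real.exp (-(k.im * s)) < ρ := (le_max_right _ _).trans_lt hρz
  have hb := inv_bounds hρ1 hρ2
  refine ⟨ρ⁻¹, hb.1, hb.2, ?_⟩
  rw [inv_mul_lt_iff₀ ((Real.exp_pos _).trans hρ1), mul_one]
  exact (le_max_left _ _).trans_lt hρz

lemma IsKernelFactorization.Kp_ne_zero (hk : 0 < k.im) (hs : 0 < s)
    (h : IsKernelFactorization k a s Kp Km) {z : ℂ} (hz : ‖z‖ < Real.exp (k.im * s)) :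
    Kp z ≠ 0 := by
  obtain ⟨L, hL, h⟩ := h
  obtain ⟨ρ, h1, h2, h3⟩ := exists_radius_lt hk hs hz
  rw [(h ρ h1 h2).1 z h3]
  exact exp_ne_zero _

lemma IsKernelFactorization.Km_inv (hk : 0 < k.im) (hs : 0 < s)
    (h : IsKernelFactorization k a s Kp Km) {z : ℂ} (hz0 : z ≠ 0)
    (hz : ‖z‖ < Real.exp (k.im * s)) : Km z⁻¹ = Kp z := by
  obtain ⟨L, hL, h⟩ := h
  obtain ⟨ρ, h1, h2, h3⟩ := exists_radius_lt hk hs hz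
  have hρ : ρ < ‖z⁻¹‖ := by
    rw [norm_inv, ← one_div, lt_div_iff₀ (norm_pos_iff.2 hz0)]
    exact h3
  rw [(h ρ h1 h2).1 z h3, (h ρ h1 h2).2 _ hρ]
  have := fun ξ => mul_div_mul_sub_one_inv z⁻¹ ξ (inv_ne_zero hz0)
  simp only [inv_inv] at this
  simp only [this, div_eq_mul_inv]

lemma OmegaMinus_ne_zero {z : ℂ} (hz : z ∈ OmegaMinus k s) : z ≠ 0 :=
  norm_pos_iff.1 ((Real.exp_pos _).trans hz)

lemma norm_inv_lt_of_mem_OmegaMinus {z : ℂ} (hz : z ∈ OmegaMinus k s) :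
    ‖z⁻¹‖ < Real.exp (k.im * s) := by
  have h := inv_strictAnti₀ (Real.exp_pos _) hz
  rwa [Real.exp_neg, inv_inv, ← norm_inv] at h

lemma IsKernelFactorization.Km_eq (hk : 0 < k.im) (hs : 0 < s)
    (h : IsKernelFactorization k a s Kp Km) {z : ℂ} (hz : z ∈ OmegaMinus k s) :
    Km z = Kp z⁻¹ := by
  rw [← h.Km_inv hk hs (inv_ne_zero (OmegaMinus_ne_zero hz)) (norm_inv_lt_of_mem_OmegaMinus hz),
    inv_inv]

lemma IsKernelFactorization.differentiableOn_Km (hk : 0 < k.im) (hs : 0 < s)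
    (h : IsKernelFactorization k a s Kp Km) : DifferentiableOn ℂ Km (OmegaMinus k s) := by
  refine DifferentiableOn.congr (f := fun z => Kp z⁻¹) ?_ fun z hz => h.Km_eq hk hs hz
  exact (h.differentiableOn_Kp hk hs).comp
    (fun z hz => (differentiableAt_inv (OmegaMinus_ne_zero hz)).differentiableWithinAt)
    fun z hz => norm_inv_lt_of_mem_OmegaMinus hz

lemma IsKernelFactorization.Km_ne_zero (hk : 0 < k.im) (hs : 0 < s)
    (h : IsKernelFactorization k a s Kp Km) {z : ℂ} (hz : z ∈ OmegaMinus k s) : Km z ≠ 0 := by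
  rw [h.Km_eq hk hs hz]
  exact h.Kp_ne_zero hk hs (norm_inv_lt_of_mem_OmegaMinus hz)

/-- K⁺ is computed on a circle outside z (after inversion) and K⁻ on one inside. The two copies of
ln K⁰ cancel, and Cauchy's formula on the annulus leaves L(z). -/
theorem IsKernelFactorization.kernel_eq_mul (hk : 0 < k.im) (hs : 0 < s)
    (h : IsKernelFactorization k a s Kp Km) {z : ℂ} (hz : z ∈ kernelAnnulus k s) :
    kernel k a s z = Kp z * Km z := by
  obtain ⟨L, hL, h⟩ := h
  obtain ⟨ρ₁, h1, h1z⟩ := exists_between hz.1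
  obtain ⟨ρ₂, h2z, h2⟩ := exists_between hz.2
  have h12 : ρ₁ ≤ ρ₂ := (h1z.trans h2z).le
  have hρ2 : 0 < ρ₂ := (norm_nonneg z).trans_lt h2z
  have hb := inv_bounds (h1.trans_le h12) h2
  have hp := (h ρ₂⁻¹ hb.1 hb.2).1 z (by rw [inv_mul_lt_iff₀ hρ2, mul_one]; exact h2z)
  have hm := (h ρ₁ h1 (h12.trans_lt h2)).2 z h1z
  have hp2 := logKp_inv hk hs hL (h1.trans_le h12) h2 h2z
  rw [logKp] at hp2
  rw [hp2] at hp
  have hc := cauchy_annulus hL h1 h2 h1z h2z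
  rw [hp, hm, ← exp_add, ← hL.2 z hz, logK0_eq hL h1 h12 h2, ← hc]
  congr 1
  simp only [div_eq_inv_mul]
  ring

end

lemma hasSum_of_forall_eq {ι : Type*} {f g : ι → ℂ} {a : ℂ} (hfg : ∀ i, f i = g i)
    (h : HasSum g a) : HasSum f a := by
  rwa [funext hfg]

/-! ### Triangular operators on sequences -/

/-- The lower triangular Toeplitz operator with symbol `∑ aₙ zⁿ`. -/
def lowerToeplitz (a A : ℕ → ℂ) (m : ℕ) : ℂ :=
  ∑ n ∈ Finset.range (m + 1), a (m - n) * A n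

/-- The upper triangular Toeplitz operator with symbol `∑ aₙ z⁻ⁿ`. -/
noncomputable def upperToeplitz (a B : ℕ → ℂ) (m : ℕ) : ℂ :=
  ∑' p : ℕ, a p * B (m + p)

lemma lowerToeplitz_eq_coeff (a A : ℕ → ℂ) (m : ℕ) :
    lowerToeplitz a A m = PowerSeries.coeff m (PowerSeries.mk a * PowerSeries.mk A) := by
  rw [mul_comm, PowerSeries.coeff_mul, Finset.Nat.sum_antidiagonal_eq_sum_range_succ_mk,
    lowerToeplitz]
  exact Finset.sum_congr rfl fun n _ => by simp [mul_comm]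

lemma lowerToeplitz_lowerToeplitz {a b : ℕ → ℂ} (h : PowerSeries.mk a * PowerSeries.mk b = 1)
    (A : ℕ → ℂ) : lowerToeplitz a (lowerToeplitz b A) = A := by
  have h1 : PowerSeries.mk (lowerToeplitz b A) = PowerSeries.mk b * PowerSeries.mk A := by
    ext m
    rw [PowerSeries.coeff_mk, lowerToeplitz_eq_coeff]
  funext m
  rw [lowerToeplitz_eq_coeff, h1, ← mul_assoc, h, one_mul, PowerSeries.coeff_mk]

/-- Grouping the double series by antidiagonals produces the coefficients of the product power
series, of which only the constant one survives. The growth bound on B justifies the regrouping. -/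
lemma upperToeplitz_upperToeplitz {a b : ℕ → ℂ} (h : PowerSeries.mk a * PowerSeries.mk b = 1)
    {x : ℝ} (hx : 0 ≤ x) (ha : Summable fun n => ‖a n‖ * x ^ n)
    (hb : Summable fun n => ‖b n‖ * x ^ n) {B : ℕ → ℂ} {C : ℝ} (hB : ∀ n, ‖B n‖ ≤ C * x ^ n) :
    upperToeplitz a (upperToeplitz b B) = B := by
  funext m
  have hsum : Summable fun y : ℕ × ℕ => a y.1 * (b y.2 * B (m + y.1 + y.2)) := by
    refine Summable.of_norm_bounded ((ha.mul_of_nonneg hb (fun n => by positivity)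
      (fun n => by positivity)).mul_left (C * x ^ m)) fun y => ?_
    rw [norm_mul, norm_mul]
    calc ‖a y.1‖ * (‖b y.2‖ * ‖B (m + y.1 + y.2)‖)
        ≤ ‖a y.1‖ * (‖b y.2‖ * (C * x ^ (m + y.1 + y.2))) := by
          gcongr
          exact hB _
      _ = _ := by rw [pow_add, pow_add]; ring
  have h1 : upperToeplitz a (upperToeplitz b B) m
      = ∑' y : ℕ × ℕ, a y.1 * (b y.2 * B (m + y.1 + y.2)) := by
    rw [hsum.tsum_prod]
    simp only [upperToeplitz, tsum_mul_left]
  have h2 := (Finset.HasAntidiagonal.sigmaAntidiagonalEquivProd (A := ℕ)).hasSum_iff.2 hsum.hasSum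
  have h3 := h2.sigma (fun n => (hasSum_fintype _))
  have h4 : ∀ n : ℕ, ∑ y : Finset.HasAntidiagonal.antidiagonal n,
      ((fun y : ℕ × ℕ => a y.1 * (b y.2 * B (m + y.1 + y.2)))
        ∘ Finset.HasAntidiagonal.sigmaAntidiagonalEquivProd) ⟨n, y⟩ = if n = 0 then B m else 0 := by
    intro n
    have h5 : ∑ y : Finset.HasAntidiagonal.antidiagonal n,
        ((fun y : ℕ × ℕ => a y.1 * (b y.2 * B (m + y.1 + y.2)))
          ∘ Finset.HasAntidiagonal.sigmaAntidiagonalEquivProd) ⟨n, y⟩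
        = ∑ y ∈ Finset.HasAntidiagonal.antidiagonal n, a y.1 * b y.2 * B (m + n) := by
      rw [← Finset.sum_coe_sort (Finset.HasAntidiagonal.antidiagonal n)]
      refine Finset.sum_congr rfl fun y _ => ?_
      have hy := Finset.HasAntidiagonal.mem_antidiagonal.1 y.2
      simp only [Function.comp, Finset.HasAntidiagonal.sigmaAntidiagonalEquivProd_apply]
      rw [add_assoc, hy, mul_assoc]
    have h6 := congrArg (PowerSeries.coeff n) h
    rw [PowerSeries.coeff_mul, PowerSeries.coeff_one] at h6
    simp only [PowerSeries.coeff_mk] at h6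
    rw [h5, ← Finset.sum_mul, h6]
    split_ifs with hn
    · rw [hn, one_mul, add_zero]
    · rw [zero_mul]
  simp only [h4] at h3
  rw [h1]
  exact h3.unique (hasSum_ite_eq 0 (B m))

lemma norm_le_of_summable_mul_pow {a : ℕ → ℂ} {x : ℝ} (hx : 0 ≤ x)
    (ha : Summable fun n => ‖a n‖ * x ^ n) (n : ℕ) :
    ‖a n‖ * x ^ n ≤ ∑' n, ‖a n‖ * x ^ n :=
  ha.le_tsum n fun _ _ => by positivity

lemma norm_lowerToeplitz_le {a A : ℕ → ℂ} {ρ : ℝ} (hρ : 0 < ρ)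
    (ha : Summable fun n => ‖a n‖ * ρ ^ n) (hA : Summable fun n => ‖A n‖ * ρ ^ n) (m : ℕ) :
    ‖lowerToeplitz a A m‖ ≤ ((∑' n, ‖a n‖ * ρ ^ n) * ∑' n, ‖A n‖ * ρ ^ n) * ρ⁻¹ ^ m := by
  rw [inv_pow, ← div_eq_mul_inv, le_div_iff₀ (pow_pos hρ m)]
  calc ‖lowerToeplitz a A m‖ * ρ ^ m
      ≤ (∑ n ∈ Finset.range (m + 1), ‖a (m - n)‖ * ‖A n‖) * ρ ^ m := by
        gcongr
        exact (norm_sum_le _ _).trans_eq (Finset.sum_congr rfl fun n _ => norm_mul _ _)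
    _ = ∑ n ∈ Finset.range (m + 1), (‖a (m - n)‖ * ρ ^ (m - n)) * (‖A n‖ * ρ ^ n) := by
        rw [Finset.sum_mul]
        refine Finset.sum_congr rfl fun n hn => ?_
        have hnm : n ≤ m := Nat.lt_succ_iff.1 (Finset.mem_range.1 hn)
        have : ρ ^ m = ρ ^ (m - n) * ρ ^ n := by rw [← pow_add, Nat.sub_add_cancel hnm]
        rw [this]
        ring
    _ ≤ ∑ n ∈ Finset.range (m + 1), (∑' n, ‖a n‖ * ρ ^ n) * (‖A n‖ * ρ ^ n) := by
        refine Finset.sum_le_sum fun n _ => ?_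
        gcongr
        exact norm_le_of_summable_mul_pow hρ.le ha _
    _ ≤ _ := by
        rw [← Finset.mul_sum]
        refine mul_le_mul_of_nonneg_left (hA.sum_le_tsum _ fun _ _ => by positivity)
          (tsum_nonneg fun _ => by positivity)

/-- A symmetric Toeplitz operator whose symbol is `f(z) f(1/z)` is the product of the triangular
operators with symbols `f(1/z)` and `f(z)`. -/
lemma hasSum_symmetric_toeplitz {a h A : ℕ → ℂ} {ρ : ℝ} (hρ : 0 < ρ)
    (ha : Summable fun n => ‖a n‖ * ρ ^ n) (ha' : Summable fun n => ‖a n‖ * ρ⁻¹ ^ n)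
    (hA : Summable fun n => ‖A n‖ * ρ ^ n)
    (hh : ∀ d, HasSum (fun i => a (i + d) * a i) (h d)) (m : ℕ) :
    HasSum (fun n : ℕ => A n * h ((m : ℤ) - n).natAbs)
      (upperToeplitz a (lowerToeplitz a A) m) := by
  -- This double family, with a extended by 0 to negative indices, is summed in both orders: over
  -- the second index it gives the Toeplitz entry, over the first the lower triangular operator.
  set f : ℕ × ℕ → ℂ := fun y => A y.1 * (a y.2 * if y.1 ≤ m + y.2 then a (m + y.2 - y.1) else 0)
    with hf
  set C := ∑' n, ‖a n‖ * ρ ^ n with hC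
  have hsum : Summable f := by
    refine Summable.of_norm_bounded ((hA.mul_of_nonneg ha' (fun n => by positivity)
      (fun n => by positivity)).mul_left (C * ρ⁻¹ ^ m)) fun y => ?_
    have hC0 : 0 ≤ C := tsum_nonneg fun _ => by positivity
    have key : ‖if y.1 ≤ m + y.2 then a (m + y.2 - y.1) else 0‖
        ≤ C * (ρ⁻¹ ^ m * ρ⁻¹ ^ y.2 * ρ ^ y.1) := by
      split_ifs with hy
      · have h1 := norm_le_of_summable_mul_pow hρ.le ha (m + y.2 - y.1)
        rw [← hC, ← le_div_iff₀ (pow_pos hρ _)] at h1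
        refine h1.trans_eq ?_
        have h2 : ρ ^ m * ρ ^ y.2 = ρ ^ (m + y.2 - y.1) * ρ ^ y.1 := by
          rw [← pow_add, ← pow_add, Nat.sub_add_cancel hy]
        rw [inv_pow, inv_pow, ← mul_inv, h2]
        field_simp
      · rw [norm_zero]
        positivity
    rw [hf, norm_mul, norm_mul]
    calc _ ≤ ‖A y.1‖ * (‖a y.2‖ * (C * (ρ⁻¹ ^ m * ρ⁻¹ ^ y.2 * ρ ^ y.1))) := by gcongr
      _ = _ := by ring
  have hrow : ∀ n, HasSum (fun i => f (n, i)) (A n * h ((m : ℤ) - n).natAbs) := by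
    intro n
    refine HasSum.mul_left _ ?_
    rcases le_total n m with hnm | hnm
    · have h1 : ((m : ℤ) - n).natAbs = m - n := by omega
      rw [h1]
      refine hasSum_of_forall_eq (fun i => ?_) (hh (m - n))
      rw [if_pos (by omega), mul_comm]
      congr 2
      omega
    · have h1 : ((m : ℤ) - n).natAbs = n - m := by omega
      rw [h1]
      -- For m ≤ n the terms with i < n - m vanish, so the index is shifted by n - m.
      refine ((add_left_injective (n - m)).hasSum_iff fun i hi => ?_).1 ?_
      · rw [if_neg, mul_zero]
        intro hle
        exact hi ⟨i - (n - m), by change i - (n - m) + (n - m) = i; omega⟩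
      · refine hasSum_of_forall_eq (fun i => ?_) (hh (n - m))
        simp only [Function.comp]
        rw [if_pos (by omega)]
        congr 2
        omega
  have hcol : ∀ i, HasSum (fun n => f (n, i)) (a i * lowerToeplitz a A (m + i)) := by
    intro i
    have h1 : a i * lowerToeplitz a A (m + i) = ∑ n ∈ Finset.range (m + i + 1), f (n, i) := by
      rw [lowerToeplitz, Finset.mul_sum]
      refine Finset.sum_congr rfl fun n hn => ?_
      have hnm : n ≤ m + i := Nat.lt_succ_iff.1 (Finset.mem_range.1 hn)
      simp only [hf, if_pos hnm]
      ring
    rw [h1]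
    refine hasSum_sum_of_ne_finset_zero fun n hn => ?_
    have hnm : ¬ n ≤ m + i := fun hle => hn (Finset.mem_range.2 (Nat.lt_succ_iff.2 hle))
    simp only [hf, if_neg hnm, mul_zero]
  have htot := hsum.hasSum
  have hrows := htot.prod_fiberwise hrow
  have hcols := ((Equiv.prodComm ℕ ℕ).hasSum_iff.2 htot).prod_fiberwise
    (f := f ∘ Equiv.prodComm ℕ ℕ) hcol
  rw [upperToeplitz, hcols.tsum_eq]
  exact hrows

/-! ### Taylor coefficients -/

/-- The Taylor coefficients of `f` at `0`. -/
noncomputable def taylorCoeff (f : ℂ → ℂ) (n : ℕ) : ℂ :=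
  iteratedDeriv n f 0 / (n.factorial : ℂ)

lemma lam_eq_taylorCoeff (Kp : ℂ → ℂ) : lam Kp = taylorCoeff fun z => (Kp z)⁻¹ := rfl

lemma hasSum_taylorCoeff {f : ℂ → ℂ} {R : ℝ} (hf : DifferentiableOn ℂ f (ball 0 R)) {z : ℂ}
    (hz : ‖z‖ < R) : HasSum (fun n => taylorCoeff f n * z ^ n) (f z) := by
  refine hasSum_of_forall_eq (fun n => ?_) (hasSum_taylorSeries_on_ball hf (mem_ball_zero_iff.2 hz))
  simp only [taylorCoeff, sub_zero, smul_eq_mul, div_eq_inv_mul]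
  ring

lemma summable_norm_taylorCoeff {f : ℂ → ℂ} {R : ℝ} (hf : DifferentiableOn ℂ f (ball 0 R))
    {x : ℝ} (hx0 : 0 ≤ x) (hx : x < R) : Summable fun n => ‖taylorCoeff f n‖ * x ^ n := by
  have h := (hasSum_taylorCoeff hf (z := (x : ℂ)) (by simpa [abs_of_nonneg hx0] using hx))
  simpa [abs_of_nonneg hx0] using h.summable.norm

lemma mk_taylorCoeff_mul {f g : ℂ → ℂ} (hf : AnalyticAt ℂ f 0) (hg : AnalyticAt ℂ g 0) :
    PowerSeries.mk (taylorCoeff f) * PowerSeries.mk (taylorCoeff g)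
      = PowerSeries.mk (taylorCoeff (f * g)) := by
  ext n
  rw [PowerSeries.coeff_mul, Finset.Nat.sum_antidiagonal_eq_sum_range_succ_mk,
    PowerSeries.coeff_mk, taylorCoeff, iteratedDeriv_mul hf.contDiffAt hg.contDiffAt,
    Finset.sum_div]
  refine Finset.sum_congr rfl fun i hi => ?_
  have hin : i ≤ n := Nat.lt_succ_iff.1 (Finset.mem_range.1 hi)
  simp only [PowerSeries.coeff_mk, taylorCoeff]
  have h1 := Nat.cast_choose ℂ hin
  have h2 : (n.factorial : ℂ) ≠ 0 := by exact_mod_cast n.factorial_ne_zero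
  have h3 : (i.factorial : ℂ) ≠ 0 := by exact_mod_cast i.factorial_ne_zero
  have h4 : ((n - i).factorial : ℂ) ≠ 0 := by exact_mod_cast (n - i).factorial_ne_zero
  rw [h1]
  field_simp

/-- This formal identity is what makes the triangular operators of K⁺ and 1/K⁺ inverse to each
other. -/
lemma mk_taylorCoeff_mul_inv {f : ℂ → ℂ} (hf : AnalyticAt ℂ f 0) (h0 : f 0 ≠ 0) :
    PowerSeries.mk (taylorCoeff f) * PowerSeries.mk (taylorCoeff fun z => (f z)⁻¹) = 1 := by
  rw [mk_taylorCoeff_mul (g := fun z => (f z)⁻¹) hf (hf.inv h0)]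
  have heq : (f * fun z => (f z)⁻¹) =ᶠ[nhds 0] fun _ => 1 := by
    filter_upwards [hf.continuousAt.eventually_ne h0] with z hz
    exact mul_inv_cancel₀ hz
  ext n
  rw [PowerSeries.coeff_mk, taylorCoeff, heq.iteratedDeriv_eq, iteratedDeriv_const,
    PowerSeries.coeff_one]
  split_ifs with hn
  · simp [hn]
  · simp

/-! ### Uniqueness of Fourier coefficients -/

lemma integral_exp_int_mul (n : ℤ) :
    ∫ t in (0 : ℝ)..2 * Real.pi, exp (I * n * t) = if n = 0 then 2 * Real.pi else 0 := by
  split_ifs with hn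
  · simp [hn]
  · have hc : I * (n : ℂ) ≠ 0 := mul_ne_zero I_ne_zero (by exact_mod_cast hn)
    rw [integral_exp_mul_complex hc]
    have : exp (I * n * (2 * Real.pi : ℝ)) = 1 := by
      rw [← exp_int_mul_two_pi_mul_I n]
      push_cast
      ring_nf
    rw [this]
    simp

/-- The exponent map e need not be injective, so the same statement serves a Laurent series and a
product of two Taylor series indexed by pairs. -/
lemma hasSum_fourierCoeff {ι : Type*} [Countable ι] {c : ι → ℂ} (hc : Summable fun i => ‖c i‖)
    (e : ι → ℤ) {f : ℝ → ℂ} (hf : ∀ t : ℝ, HasSum (fun i => c i * exp (I * e i * t)) (f t))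
    (m : ℤ) :
    HasSum (fun i => if e i = m then c i else 0)
      ((2 * Real.pi : ℂ)⁻¹ * ∫ t in (0 : ℝ)..2 * Real.pi, exp (-(I * m * t)) * f t) := by
  have hpi : (0 : ℝ) ≤ 2 * Real.pi := Real.two_pi_pos.le
  have hpi' : (2 * Real.pi : ℂ) ≠ 0 := by exact_mod_cast Real.two_pi_pos.ne'
  have hnorm : ∀ (n : ℤ) (t : ℝ), ‖exp (I * n * t)‖ = 1 := by
    intro n t
    have : I * n * t = ((n * t : ℝ) : ℂ) * I := by push_cast; ring
    rw [this, norm_exp_ofReal_mul_I]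
  have key := MeasureTheory.hasSum_integral_of_summable_integral_norm
    (μ := MeasureTheory.volume.restrict (Ioc 0 (2 * Real.pi)))
    (F := fun (i : ι) (t : ℝ) => c i * exp (I * (e i - m : ℤ) * t))
    (fun i => Continuous.integrableOn_Ioc (by fun_prop)) (by
      simp only [norm_mul, hnorm, mul_one, MeasureTheory.integral_const, smul_eq_mul]
      exact hc.mul_left _)
  have h1 : ∀ t : ℝ, ∑' i, c i * exp (I * (e i - m : ℤ) * t) = exp (-(I * m * t)) * f t := by
    intro t
    rw [← ((hf t).mul_left (exp (-(I * m * t)))).tsum_eq]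
    refine tsum_congr fun i => ?_
    rw [mul_left_comm, ← exp_add]
    push_cast
    ring_nf
  simp only [h1, ← intervalIntegral.integral_of_le hpi, intervalIntegral.integral_const_mul,
    integral_exp_int_mul, sub_eq_zero] at key
  have h2 := key.mul_left (2 * Real.pi : ℂ)⁻¹
  refine hasSum_of_forall_eq (fun i => ?_) h2
  split_ifs
  · push_cast; field_simp
  · simp

/-! ### Laurent coefficients of the kernel -/

/-- The Laurent coefficient of `z ^ d` and `z ^ (-d)` in the kernel. -/
noncomputable def kernelCoeff (k : ℂ) (a s : ℝ) (d : ℕ) : ℂ :=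
  if d = 0 then hankel (k * a) else hankel (k * (s * d : ℝ))

section

variable {k : ℂ} {a s : ℝ} {Kp Km : ℂ → ℂ}

lemma one_lt_exp_mul (hk : 0 < k.im) (hs : 0 < s) : 1 < Real.exp (k.im * s) :=
  Real.one_lt_exp_iff.2 (mul_pos hk hs)

lemma mem_kernelAnnulus_of_norm_eq_one (hk : 0 < k.im) (hs : 0 < s) {z : ℂ} (hz : ‖z‖ = 1) :
    z ∈ kernelAnnulus k s :=
  ⟨by rw [hz, Real.exp_lt_one_iff]; linarith [mul_pos hk hs], by
    rw [hz]; exact one_lt_exp_mul hk hs⟩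

lemma norm_exp_I_mul (t : ℝ) : ‖exp (I * t)‖ = 1 := by
  rw [mul_comm, norm_exp_ofReal_mul_I]

lemma hasSum_kernelCoeff (hk : 0 < k.im) (hs : 0 < s) (t : ℝ) :
    HasSum (fun l : ℤ => kernelCoeff k a s l.natAbs * exp (I * l * t))
      (kernel k a s (exp (I * t))) := by
  have hz := mem_kernelAnnulus_of_norm_eq_one hk hs (norm_exp_I_mul t)
  have hpow : ∀ n : ℕ, exp (I * (n : ℤ) * t) = exp (I * t) ^ n := by
    intro n
    rw [← exp_nat_mul]
    push_cast
    ring_nf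
  have hpow' : ∀ n : ℕ, exp (I * (-(n + 1) : ℤ) * t) = (exp (I * t))⁻¹ ^ (n + 1) := by
    intro n
    rw [← exp_neg, ← exp_nat_mul]
    push_cast
    ring_nf
  have h1 : HasSum (fun n : ℕ => kernelCoeff k a s (n : ℤ).natAbs * exp (I * (n : ℤ) * t))
      (latticeSeries k s (exp (I * t)) + hankel (k * a)) := by
    have h2 := (hasSum_nat_add_iff
      (f := fun n : ℕ => kernelCoeff k a s (n : ℤ).natAbs * exp (I * (n : ℤ) * t))
      (g := latticeSeries k s (exp (I * t))) 1).1 ?_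
    · simpa [kernelCoeff] using h2
    · refine hasSum_of_forall_eq (fun n => ?_) (summable_latticeSeries hk hs hz.2).hasSum
      rw [hpow, Int.natAbs_natCast, kernelCoeff, if_neg n.succ_ne_zero]
      push_cast
      rfl
  have h2 : HasSum (fun n : ℕ => kernelCoeff k a s (-(n + 1) : ℤ).natAbs
      * exp (I * (-(n + 1) : ℤ) * t)) (latticeSeries k s (exp (I * t))⁻¹) := by
    refine hasSum_of_forall_eq (fun n => ?_)
      (summable_latticeSeries hk hs (inv_mem_kernelAnnulus hz).2).hasSum
    have h3 : (-(n + 1) : ℤ).natAbs = n + 1 := by omega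
    rw [hpow', h3, kernelCoeff, if_neg n.succ_ne_zero]
    push_cast
    rfl
  have h3 := HasSum.of_nat_of_neg_add_one
    (f := fun l : ℤ => kernelCoeff k a s l.natAbs * exp (I * l * t)) h1 h2
  rw [kernel_eq_latticeSeries hk a hs hz]
  convert h3 using 1
  ring

lemma IsKernelFactorization.differentiableOn_ball (hk : 0 < k.im) (hs : 0 < s)
    (h : IsKernelFactorization k a s Kp Km) :
    DifferentiableOn ℂ Kp (ball 0 (Real.exp (k.im * s))) :=
  (h.differentiableOn_Kp hk hs).mono fun _ hz => mem_ball_zero_iff.1 hz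

lemma IsKernelFactorization.differentiableOn_inv (hk : 0 < k.im) (hs : 0 < s)
    (h : IsKernelFactorization k a s Kp Km) :
    DifferentiableOn ℂ (fun z => (Kp z)⁻¹) (ball 0 (Real.exp (k.im * s))) :=
  (h.differentiableOn_ball hk hs).inv fun _ hz => h.Kp_ne_zero hk hs (mem_ball_zero_iff.1 hz)

lemma IsKernelFactorization.summable_taylorCoeff (hk : 0 < k.im) (hs : 0 < s)
    (h : IsKernelFactorization k a s Kp Km) {x : ℝ} (hx0 : 0 ≤ x) (hx : x < Real.exp (k.im * s)) :
    Summable fun n => ‖taylorCoeff Kp n‖ * x ^ n :=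
  summable_norm_taylorCoeff (h.differentiableOn_ball hk hs) hx0 hx

lemma IsKernelFactorization.summable_lam (hk : 0 < k.im) (hs : 0 < s)
    (h : IsKernelFactorization k a s Kp Km) {x : ℝ} (hx0 : 0 ≤ x) (hx : x < Real.exp (k.im * s)) :
    Summable fun n => ‖lam Kp n‖ * x ^ n :=
  summable_norm_taylorCoeff (h.differentiableOn_inv hk hs) hx0 hx

lemma IsKernelFactorization.mk_mul_mk_lam (hk : 0 < k.im) (hs : 0 < s)
    (h : IsKernelFactorization k a s Kp Km) :
    PowerSeries.mk (taylorCoeff Kp) * PowerSeries.mk (lam Kp) = 1 := by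
  refine mk_taylorCoeff_mul_inv ?_ (h.Kp_ne_zero hk hs (by simpa using Real.exp_pos _))
  exact (h.differentiableOn_ball hk hs).analyticAt (ball_mem_nhds _ (Real.exp_pos _))

/-- The factorization `K = K⁺ K⁻` in terms of coefficients. -/
lemma IsKernelFactorization.hasSum_kernelCoeff (hk : 0 < k.im) (hs : 0 < s)
    (h : IsKernelFactorization k a s Kp Km) (d : ℕ) :
    HasSum (fun i => taylorCoeff Kp (i + d) * taylorCoeff Kp i) (kernelCoeff k a s d) := by
  set κ := taylorCoeff Kp with hκ
  have hκs : Summable fun n => ‖κ n‖ := by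
    simpa using h.summable_taylorCoeff hk hs zero_le_one (one_lt_exp_mul hk hs)
  have hc1 : Summable fun l : ℤ => ‖kernelCoeff k a s l.natAbs‖ := by
    have := (FoldyArrays.hasSum_kernelCoeff (a := a) hk hs 0).summable.norm
    simpa using this
  have h1 := hasSum_fourierCoeff hc1 (fun l => l) (FoldyArrays.hasSum_kernelCoeff hk hs) d
  have hc2 : Summable fun y : ℕ × ℕ => ‖κ y.1 * κ y.2‖ := by
    simpa only [norm_mul] using hκs.mul_of_nonneg hκs (fun _ => norm_nonneg _)
      (fun _ => norm_nonneg _)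
  have h2 := hasSum_fourierCoeff hc2 (fun y => (y.1 : ℤ) - y.2)
    (f := fun t => kernel k a s (exp (I * t))) (fun t => ?_) d
  · have h3 := h1.unique (hasSum_ite_eq (d : ℤ) (kernelCoeff k a s d) |> hasSum_of_forall_eq
      fun l => by by_cases hl : l = (d : ℤ) <;> simp [hl])
    rw [h3] at h2
    -- The pairs contributing to frequency d are exactly the (i + d, i).
    have hinj : Function.Injective fun i : ℕ => (i + d, i) := fun i j hij => (Prod.ext_iff.1 hij).2
    refine hasSum_of_forall_eq (fun i => ?_) ((hinj.hasSum_iff fun y hy => ?_).2 h2)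
    · simp [Function.comp]
    · rw [if_neg]
      intro hyd
      exact hy ⟨y.2, Prod.ext (by change y.2 + d = y.1; omega) rfl⟩
  · have hz := mem_kernelAnnulus_of_norm_eq_one hk hs (norm_exp_I_mul t)
    have hz' := inv_mem_kernelAnnulus hz
    have hd := h.differentiableOn_ball hk hs
    rw [h.kernel_eq_mul hk hs hz, h.Km_eq hk hs hz.1]
    refine hasSum_of_forall_eq (fun y => ?_) ((hasSum_taylorCoeff hd hz.2).mul
      (hasSum_taylorCoeff hd hz'.2) ?_)
    · rw [← hκ, ← exp_neg, ← exp_nat_mul, ← exp_nat_mul, mul_mul_mul_comm, ← exp_add]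
      push_cast
      ring_nf
    · refine Summable.of_norm (hc2.congr fun y => ?_)
      simp only [norm_mul, norm_pow, norm_inv, norm_exp_I_mul, inv_one, one_pow, mul_one, hκ]

/-! ### The Foldy operator of a single array -/

/-- The left-hand side of the Foldy system of a single array. -/
noncomputable def foldyOperator (k : ℂ) (a s : ℝ) (A : ℕ → ℂ) (m : ℕ) : ℂ :=
  A m * hankel (k * a)
    + ∑' n : ℕ, (if n = m then 0 else A n * hankel (k * (s * |(m : ℝ) - (n : ℝ)| : ℝ)))

lemma foldyOperator_eq (hk : 0 < k.im) (hs : 0 < s) (h : IsKernelFactorization k a s Kp Km)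
    {ρ : ℝ} (h1 : Real.exp (-(k.im * s)) < ρ) (h2 : ρ < Real.exp (k.im * s)) {A : ℕ → ℂ}
    (hA : Summable fun n => ‖A n‖ * ρ ^ n) :
    foldyOperator k a s A
      = upperToeplitz (taylorCoeff Kp) (lowerToeplitz (taylorCoeff Kp) A) := by
  have hρ : 0 < ρ := (Real.exp_pos _).trans h1
  have hb := inv_bounds h1 h2
  funext m
  have hT := hasSum_symmetric_toeplitz hρ (h.summable_taylorCoeff hk hs hρ.le h2)
    (h.summable_taylorCoeff hk hs (inv_nonneg.2 hρ.le) hb.2) hA (h.hasSum_kernelCoeff hk hs) m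
  rw [← hT.tsum_eq, hT.summable.tsum_eq_add_tsum_ite m, foldyOperator]
  congr 1
  · simp [kernelCoeff]
  · refine tsum_congr fun n => ?_
    split_ifs with hn
    · rfl
    · have h3 : ((m : ℤ) - n).natAbs ≠ 0 := by omega
      rw [kernelCoeff, if_neg h3]
      have h4 : ((((m : ℤ) - n).natAbs : ℕ) : ℝ) = |(m : ℝ) - n| := by
        rw [Nat.cast_natAbs]
        push_cast
        rfl
      rw [h4]

/-- The Wiener–Hopf inverse of the Foldy operator. -/
lemma eq_lowerToeplitz_upperToeplitz_foldyOperator (hk : 0 < k.im) (hs : 0 < s)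
    (h : IsKernelFactorization k a s Kp Km) {ρ : ℝ} (h1 : Real.exp (-(k.im * s)) < ρ)
    (h2 : ρ < Real.exp (k.im * s)) {A : ℕ → ℂ} (hA : Summable fun n => ‖A n‖ * ρ ^ n) :
    A = lowerToeplitz (lam Kp) (upperToeplitz (lam Kp) (foldyOperator k a s A)) := by
  have hρ : 0 < ρ := (Real.exp_pos _).trans h1
  have hb := inv_bounds h1 h2
  have hmul : PowerSeries.mk (lam Kp) * PowerSeries.mk (taylorCoeff Kp) = 1 := by
    rw [mul_comm, h.mk_mul_mk_lam hk hs]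
  rw [foldyOperator_eq hk hs h h1 h2 hA,
    upperToeplitz_upperToeplitz hmul (inv_nonneg.2 hρ.le)
      (h.summable_lam hk hs (inv_nonneg.2 hρ.le) hb.2)
      (h.summable_taylorCoeff hk hs (inv_nonneg.2 hρ.le) hb.2)
      (norm_lowerToeplitz_le hρ (h.summable_taylorCoeff hk hs hρ.le h2) hA),
    lowerToeplitz_lowerToeplitz hmul]

/-- Geometric sequences are eigenvectors of upper triangular Toeplitz operators, with eigenvalue
f(w). -/
lemma upperToeplitz_geometric {f : ℂ → ℂ} {R : ℝ} (hf : DifferentiableOn ℂ f (ball 0 R)) (c : ℂ)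
    {w : ℂ} (hw : ‖w‖ < R) (m : ℕ) :
    HasSum (fun p => taylorCoeff f p * (c * w ^ (m + p))) (c * w ^ m * f w) :=
  hasSum_of_forall_eq (fun p => by rw [pow_add]; ring)
    ((hasSum_taylorCoeff hf hw).mul_left (c * w ^ m))

lemma lowerToeplitz_eq_sum_zpow (b : ℕ → ℂ) (c z : ℂ) (m : ℕ) :
    lowerToeplitz b (fun n => c * z⁻¹ ^ n) m
      = c * ∑ n ∈ Finset.range (m + 1), b n * z ^ ((n : ℤ) - (m : ℤ)) := by
  rw [lowerToeplitz, ← Finset.sum_range_reflect, Finset.mul_sum]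
  refine Finset.sum_congr rfl fun n hn => ?_
  have hnm : n ≤ m := Nat.lt_succ_iff.1 (Finset.mem_range.1 hn)
  have h1 : m + 1 - 1 - n = m - n := by omega
  have h2 : m - (m - n) = n := by omega
  have h3 : ((n : ℤ) - m) = -((m - n : ℕ) : ℤ) := by omega
  rw [h1, h2, h3, zpow_neg, zpow_natCast, inv_pow]
  ring

end

/-! ### Geometry of the arrays -/

lemma dist_pos_zero {X : SemiInfiniteArray} (hs : 0 < X.s) (n : ℕ) :
    dist (X.pos n) (X.pos 0) = n * X.s := by
  have h : (0 : ℝ) ≤ n * X.s := by positivity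
  rw [EuclideanSpace.dist_eq, Real.sqrt_eq_iff_eq_sq (by positivity) h, Fin.sum_univ_two]
  simp only [SemiInfiniteArray.pos, Real.dist_eq, sq_abs]
  simp
  linear_combination (n * X.s) ^ 2 * Real.cos_sq_add_sin_sq X.α

/-- Triangle inequality through the first scatterers of both arrays; no assumption on their
directions is needed. -/
lemma le_scattererDist {X Y : SemiInfiniteArray} (hX : 0 < X.s) (hY : 0 < Y.s) (m q : ℕ) :
    q * Y.s - m * X.s - dist (X.pos 0) (Y.pos 0) ≤ scattererDist X Y m q := by
  have h1 := dist_triangle4 (Y.pos q) (X.pos m) (X.pos 0) (Y.pos 0)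
  rw [dist_pos_zero hY, dist_pos_zero hX, dist_comm (Y.pos q)] at h1
  rw [scattererDist]
  linarith

lemma incident_pos (k : ℂ) (θI : ℝ) (X : SemiInfiniteArray) (m : ℕ) :
    incident k θI (X.pos m) = incident k θI (X.pos 0) * (pole k θI X)⁻¹ ^ m := by
  rw [incident, incident, pole, ← exp_neg, ← exp_nat_mul, ← exp_add, Real.cos_sub]
  congr 1
  simp [SemiInfiniteArray.pos]
  ring

lemma norm_pole (k : ℂ) (θI : ℝ) (X : SemiInfiniteArray) :
    ‖pole k θI X‖ = Real.exp (-(k.im * X.s * Real.cos (X.α - θI))) := by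
  rw [pole, norm_exp]
  congr 1
  simp only [mul_re, I_re, I_im, ofReal_re, ofReal_im, mul_im]
  ring

section

variable {k : ℂ} {θI : ℝ} {X : SemiInfiniteArray} {Kp Km : ℂ → ℂ}

/-- Ω⁺ is the open disc of radius |pole|, so it can meet Ω⁻ only if the pole lies in Ω⁻. -/
lemma pole_mem_OmegaMinus (hX : (OmegaPlus k θI X ∩ OmegaMinus k X.s).Nonempty) :
    pole k θI X ∈ OmegaMinus k X.s := by
  obtain ⟨z, h1, h2⟩ := hX
  have h3 : Real.exp (-(k.im * X.s)) < ‖z‖ := h2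
  have h4 : ‖z‖ < Real.exp (-(k.im * X.s * Real.cos (X.α - θI))) := h1
  change Real.exp (-(k.im * X.s)) < ‖pole k θI X‖
  rw [norm_pole]
  exact h3.trans h4

lemma cos_lt_one_of_nonempty (hk : 0 < k.im) (hs : 0 < X.s)
    (hX : (OmegaPlus k θI X ∩ OmegaMinus k X.s).Nonempty) : Real.cos (X.α - θI) < 1 := by
  have h : Real.exp (-(k.im * X.s)) < ‖pole k θI X‖ := pole_mem_OmegaMinus hX
  rw [norm_pole, Real.exp_lt_exp] at h
  nlinarith [mul_pos hk hs]

lemma norm_pole_le (hk : 0 < k.im) (hs : 0 < X.s) : ‖pole k θI X‖ ≤ Real.exp (k.im * X.s) := by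
  rw [norm_pole, Real.exp_le_exp]
  nlinarith [Real.neg_one_le_cos (X.α - θI), mul_pos hk hs]

lemma ZTransformConverges.summable_norm {A : ℕ → ℂ} (hA : ZTransformConverges k θI X A) {ρ : ℝ}
    (h0 : 0 ≤ ρ) (h1 : ρ < ‖pole k θI X‖) : Summable fun n => ‖A n‖ * ρ ^ n := by
  rw [norm_pole] at h1
  have h2 : (ρ : ℂ) ∈ OmegaPlus k θI X := by
    change ‖(ρ : ℂ)‖ < _
    rwa [norm_real, Real.norm_of_nonneg h0]
  simpa [abs_of_nonneg h0] using (hA _ h2).norm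

/-! ### The solution for a single array -/

lemma singleArray_eq_lowerToeplitz : singleArray k θI X Kp Km = lowerToeplitz (lam Kp)
    (fun n => -(incident k θI (X.pos 0) / Km (pole k θI X)) * (pole k θI X)⁻¹ ^ n) := by
  funext m
  rw [lowerToeplitz_eq_sum_zpow, singleArray]

lemma summable_geometric_pole (c : ℂ) {ρ : ℝ} (h0 : 0 ≤ ρ) (h1 : ρ < ‖pole k θI X‖) :
    Summable fun n : ℕ => ‖c * (pole k θI X)⁻¹ ^ n‖ * ρ ^ n := by
  have h2 : 0 < ‖pole k θI X‖ := h0.trans_lt h1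
  have h3 : ‖pole k θI X‖⁻¹ * ρ < 1 := by
    rw [inv_mul_lt_iff₀ h2, mul_one]
    exact h1
  refine ((summable_geometric_of_lt_one (by positivity) h3).mul_left ‖c‖).congr fun n => ?_
  rw [norm_mul, norm_pow, norm_inv, mul_pow, mul_assoc]

/-- A lower triangular operator applied to powers of 1/pole gives terms O(ρ⁻ᵐ) for every 0 < ρ <
|pole|. -/
theorem zTransformConverges_singleArray (hk : 0 < k.im) (hs : 0 < X.s)
    (h : IsKernelFactorization k X.a X.s Kp Km) :
    ZTransformConverges k θI X (singleArray k θI X Kp Km) := by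
  intro z hz
  have hz' : ‖z‖ < ‖pole k θI X‖ := by
    rw [norm_pole]
    exact hz
  obtain ⟨ρ, h1, h2⟩ := exists_between hz'
  have hρ : 0 < ρ := (norm_nonneg z).trans_lt h1
  have hb := norm_lowerToeplitz_le hρ
    (h.summable_lam hk hs hρ.le (h2.trans_le (norm_pole_le hk hs)))
    (summable_geometric_pole (-(incident k θI (X.pos 0) / Km (pole k θI X))) hρ.le h2)
  rw [← singleArray_eq_lowerToeplitz] at hb
  have h3 : ρ⁻¹ * ‖z‖ < 1 := by
    rw [inv_mul_lt_iff₀ hρ, mul_one]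
    exact h1
  have h4 : ∀ m, ‖singleArray k θI X Kp Km m * z ^ m‖ ≤ _ * (ρ⁻¹ * ‖z‖) ^ m := fun m => by
    rw [norm_mul, norm_pow, mul_pow, ← mul_assoc]
    exact mul_le_mul_of_nonneg_right (hb m) (by positivity)
  exact Summable.of_norm_bounded
    ((summable_geometric_of_lt_one (by positivity) h3).mul_left _) h4

/-- The two lower operators cancel and leave a geometric sequence. The upper one multiplies it by
K⁺(1/pole) = K⁻(pole), the normalizing denominator of A₀. -/
lemma foldyOperator_singleArray (hk : 0 < k.im) (hs : 0 < X.s)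
    (hX : (OmegaPlus k θI X ∩ OmegaMinus k X.s).Nonempty)
    (h : IsKernelFactorization k X.a X.s Kp Km) (m : ℕ) :
    foldyOperator k X.a X.s (singleArray k θI X Kp Km) m = -incident k θI (X.pos m) := by
  have hpole := pole_mem_OmegaMinus hX
  obtain ⟨ρ, h1, h2⟩ := exists_between
    (show Real.exp (-(k.im * X.s)) < ‖pole k θI X‖ from hpole)
  have hρ : 0 < ρ := (Real.exp_pos _).trans h1
  rw [foldyOperator_eq hk hs h h1 (h2.trans_le (norm_pole_le hk hs))
    ((zTransformConverges_singleArray hk hs h).summable_norm hρ.le h2),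
    singleArray_eq_lowerToeplitz, lowerToeplitz_lowerToeplitz (h.mk_mul_mk_lam hk hs),
    upperToeplitz, (upperToeplitz_geometric (h.differentiableOn_ball hk hs) _
      (norm_inv_lt_of_mem_OmegaMinus hpole) m).tsum_eq,
    incident_pos k θI X m, ← h.Km_eq hk hs hpole]
  have := h.Km_ne_zero hk hs hpole
  field_simp

theorem isFoldySolution_singleArray (hk : 0 < k.im) (hs : 0 < X.s)
    (hX : (OmegaPlus k θI X ∩ OmegaMinus k X.s).Nonempty)
    (h : IsKernelFactorization k X.a X.s Kp Km) :
    IsFoldySolution k θI (fun _ : Fin 1 => X) (fun _ => singleArray k θI X Kp Km) := by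
  intro j m
  have h1 := foldyOperator_singleArray hk hs hX h m
  rw [foldyOperator] at h1
  rw [h1]
  have h2 : (Finset.univ : Finset (Fin 1)).erase j = ∅ := by
    ext i
    simp [Subsingleton.elim i j]
  rw [h2, Finset.sum_empty, sub_zero]

/-! ### Interactions between arrays -/

variable {Y : SemiInfiniteArray}

lemma summable_interactionTerm (hk : 0 < k.im) (hs : 0 < X.s)
    (h : IsKernelFactorization k X.a X.s Kp Km) {x₀ : ℝ} (hx₀ : 0 < x₀)
    (hdist : ∀ m n, x₀ ≤ scattererDist X Y m n) (m q : ℕ) :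
    Summable fun p : ℕ => interactionTerm k X Y Kp m q p := by
  obtain ⟨C, hC, hH⟩ := exists_norm_hankel_le hk hx₀
  have hl : Summable fun p => ‖lam Kp p‖ := by
    simpa using h.summable_lam hk hs zero_le_one (one_lt_exp_mul hk hs)
  refine summable_sum fun n _ => ?_
  refine Summable.of_norm_bounded ((hl.mul_left ‖lam Kp (m - n)‖).mul_right C) fun p => ?_
  rw [norm_mul, norm_mul]
  refine mul_le_mul_of_nonneg_left ((hH _ (hdist _ _)).trans ?_) (by positivity)
  refine mul_le_of_le_one_right hC (Real.exp_le_one_iff.2 ?_)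
  have := hx₀.trans_le (hdist (p + n) q)
  nlinarith

lemma summable_lam_mul_hankel (hk : 0 < k.im) (hXs : 0 < X.s) (hYs : 0 < Y.s)
    (hY : (OmegaPlus k θI Y ∩ OmegaMinus k Y.s).Nonempty)
    (h : IsKernelFactorization k X.a X.s Kp Km) {x₀ : ℝ} (hx₀ : 0 < x₀)
    (hdist : ∀ m n, x₀ ≤ scattererDist X Y m n) {A : ℕ → ℂ}
    (hA : ZTransformConverges k θI Y A) (n : ℕ) :
    Summable fun x : ℕ × ℕ =>
      lam Kp x.2 * (A x.1 * hankel (k * scattererDist X Y (n + x.2) x.1)) := by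
  obtain ⟨C, hC, hH⟩ := exists_norm_hankel_le hk hx₀
  -- The exponent τ balances three rates: τ > cos(α - θI) keeps A summable against exp(-τ Im(k) s
  -- q), τ < 1 keeps exp(τ Im(k) s p) within the convergence radius for λ, and only the fraction τ
  -- of the Hankel decay is spent.
  obtain ⟨τ, hτ, hτ1⟩ := exists_between
    (max_lt zero_lt_one (cos_lt_one_of_nonempty hk hYs hY))
  have hτ0 : 0 < τ := (le_max_left _ _).trans_lt hτ
  have hτc : Real.cos (Y.α - θI) < τ := (le_max_right _ _).trans_lt hτ
  have hlam := h.summable_lam hk hXs (x := Real.exp (τ * (k.im * X.s))) (Real.exp_pos _).le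
    (Real.exp_lt_exp.2 (by nlinarith [mul_pos hk hXs]))
  have hAs := hA.summable_norm (ρ := Real.exp (-(τ * (k.im * Y.s)))) (Real.exp_pos _).le (by
    rw [norm_pole, Real.exp_lt_exp]
    nlinarith [mul_pos hk hYs])
  set E : ℝ := n * X.s + dist (X.pos 0) (Y.pos 0) with hE
  refine Summable.of_norm_bounded ((hAs.mul_of_nonneg hlam (fun _ => by positivity)
    (fun _ => by positivity)).mul_left (C * Real.exp (τ * k.im * E))) fun x => ?_
  have hpos := hx₀.trans_le (hdist (n + x.2) x.1)
  have hbound : ‖hankel (k * scattererDist X Y (n + x.2) x.1)‖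
      ≤ C * (Real.exp (τ * k.im * E) * Real.exp (-(τ * (k.im * Y.s))) ^ x.1
        * Real.exp (τ * (k.im * X.s)) ^ x.2) := by
    refine (hH _ (hdist _ _)).trans (mul_le_mul_of_nonneg_left ?_ hC)
    rw [← Real.exp_nat_mul, ← Real.exp_nat_mul, ← Real.exp_add, ← Real.exp_add, Real.exp_le_exp]
    have h1 := le_scattererDist hXs hYs (n + x.2) x.1
    push_cast at h1
    have h2 : τ * k.im * (x.1 * Y.s - x.2 * X.s - E)
        ≤ τ * k.im * scattererDist X Y (n + x.2) x.1 :=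
      mul_le_mul_of_nonneg_left (by rw [hE]; linarith) (by positivity)
    have h3 : τ * (k.im * scattererDist X Y (n + x.2) x.1)
        ≤ 1 * (k.im * scattererDist X Y (n + x.2) x.1) :=
      mul_le_mul_of_nonneg_right hτ1.le (by positivity)
    linarith
  rw [norm_mul, norm_mul]
  refine (mul_le_mul_of_nonneg_left (mul_le_mul_of_nonneg_left hbound (norm_nonneg _))
    (norm_nonneg _)).trans_eq ?_
  ring

/-- The sum over the scatterers of `Y` and over `p` that describes the effect of `Y` on the
`n`-th scatterer of `X`. -/
noncomputable def interactionSum (k : ℂ) (X Y : SemiInfiniteArray) (Kp : ℂ → ℂ) (A : ℕ → ℂ)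
    (n : ℕ) : ℂ :=
  ∑' x : ℕ × ℕ, lam Kp x.2 * (A x.1 * hankel (k * scattererDist X Y (n + x.2) x.1))

/-- Summing over q first recovers the field of Y at scatterer n + p, so the total is the upper
inverse applied to that field. -/
lemma hasSum_interactionSum {A : ℕ → ℂ} {n : ℕ} (hsum : Summable fun x : ℕ × ℕ =>
      lam Kp x.2 * (A x.1 * hankel (k * scattererDist X Y (n + x.2) x.1))) :
    HasSum (fun p => lam Kp p * ∑' q, A q * hankel (k * scattererDist X Y (n + p) q))
      (interactionSum k X Y Kp A n) := by
  have h1 := (Equiv.prodComm ℕ ℕ).hasSum_iff.2 hsum.hasSum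
  refine h1.prod_fiberwise fun p => ?_
  have h2 := (h1.summable.prod_factor p).hasSum
  simp only [Function.comp, Equiv.prodComm_apply, Prod.swap] at h2 ⊢
  rwa [tsum_mul_left] at h2

lemma hasSum_interactionTerm {A : ℕ → ℂ} (hsum : ∀ n, Summable fun x : ℕ × ℕ =>
      lam Kp x.2 * (A x.1 * hankel (k * scattererDist X Y (n + x.2) x.1))) (m : ℕ) :
    HasSum (fun x : ℕ × ℕ => interactionTerm k X Y Kp m x.1 x.2 * A x.1)
      (lowerToeplitz (lam Kp) (interactionSum k X Y Kp A) m) := by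
  refine hasSum_of_forall_eq (fun x => ?_)
    (hasSum_sum fun n (_ : n ∈ Finset.range (m + 1)) => (hsum n).hasSum.mul_left (lam Kp (m - n)))
  rw [interactionTerm, Finset.sum_mul]
  refine Finset.sum_congr rfl fun n _ => ?_
  rw [add_comm n]
  ring

lemma hasSum_interactionMatrix {A : ℕ → ℂ} (hsum : ∀ n, Summable fun x : ℕ × ℕ =>
      lam Kp x.2 * (A x.1 * hankel (k * scattererDist X Y (n + x.2) x.1))) (m : ℕ) :
    HasSum (fun q : ℕ => interactionMatrix k X Y Kp m q * A q)
      (lowerToeplitz (lam Kp) (interactionSum k X Y Kp A) m) := by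
  have h1 := hasSum_interactionTerm hsum m
  refine h1.prod_fiberwise fun q => ?_
  have h2 := (h1.summable.prod_factor q).hasSum
  simp only [tsum_mul_right] at h2
  exact h2

end

/-! ### Solving the coupled systems of several arrays -/

section

variable {k : ℂ} {θI : ℝ} {J : ℕ} {X : Fin J → SemiInfiniteArray} {Kp Km : Fin J → ℂ → ℂ}
  {A : Fin J → ℕ → ℂ}

lemma Admissible.summable_lam_mul_hankel (hk : 0 < k.im) (hadm : Admissible X)
    (hX : ∀ j, (OmegaPlus k θI (X j) ∩ OmegaMinus k (X j).s).Nonempty)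
    (h : ∀ j, IsKernelFactorization k (X j).a (X j).s (Kp j) (Km j))
    (hA : ∀ j, ZTransformConverges k θI (X j) (A j)) {j l : Fin J} (hjl : j ≠ l) (n : ℕ) :
    Summable fun x : ℕ × ℕ => lam (Kp j) x.2
      * (A l x.1 * hankel (k * scattererDist (X j) (X l) (n + x.2) x.1)) :=
  FoldyArrays.summable_lam_mul_hankel hk (hadm.spacing_pos j) (hadm.spacing_pos l) (hX l) (h j)
    (add_pos (hadm.radius_pos j) (hadm.radius_pos l)) (fun m n => (hadm.other_array j l hjl m n).le)
    (hA l) n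

/-- The solution of the coupled systems in terms of the interactions. -/
theorem IsFoldySolution.eq_singleArray_sub (hk : 0 < k.im) (hadm : Admissible X)
    (hX : ∀ j, (OmegaPlus k θI (X j) ∩ OmegaMinus k (X j).s).Nonempty)
    (h : ∀ j, IsKernelFactorization k (X j).a (X j).s (Kp j) (Km j))
    (hA : ∀ j, ZTransformConverges k θI (X j) (A j)) (hsol : IsFoldySolution k θI X A)
    (j : Fin J) (m : ℕ) :
    A j m = singleArray k θI (X j) (Kp j) (Km j) m
      - ∑ l ∈ Finset.univ.erase j,
          lowerToeplitz (lam (Kp j)) (interactionSum k (X j) (X l) (Kp j) (A l)) m := by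
  have hs := hadm.spacing_pos j
  have hpole := pole_mem_OmegaMinus (hX j)
  obtain ⟨ρ, h1, h2⟩ := exists_between
    (show Real.exp (-(k.im * (X j).s)) < ‖pole k θI (X j)‖ from hpole)
  have hρ : 0 < ρ := (Real.exp_pos _).trans h1
  have hinv := eq_lowerToeplitz_upperToeplitz_foldyOperator hk hs (h j) h1
    (h2.trans_le (norm_pole_le hk hs)) ((hA j).summable_norm hρ.le h2)
  -- By the Foldy equations the operator's output is the plane wave plus the other fields, up to
  -- sign. The upper inverse divides the wave by K⁺(1/pole) = K⁻(pole) and turns each field into an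
  -- interaction sum.
  have hupper : ∀ n, upperToeplitz (lam (Kp j)) (foldyOperator k (X j).a (X j).s (A j)) n
      = -(incident k θI ((X j).pos 0) / Km j (pole k θI (X j))) * (pole k θI (X j))⁻¹ ^ n
        - ∑ l ∈ Finset.univ.erase j, interactionSum k (X j) (X l) (Kp j) (A l) n := by
    intro n
    have h3 := upperToeplitz_geometric ((h j).differentiableOn_inv hk hs)
      (-incident k θI ((X j).pos 0)) (norm_inv_lt_of_mem_OmegaMinus hpole) n
    have h4 := hasSum_sum fun l (hl : l ∈ Finset.univ.erase j) =>
      hasSum_interactionSum (hadm.summable_lam_mul_hankel hk hX h hA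
        (Finset.ne_of_mem_erase hl).symm n)
    have h5 := h3.sub h4
    have h6 : upperToeplitz (lam (Kp j)) (foldyOperator k (X j).a (X j).s (A j)) n = _ :=
      (hasSum_of_forall_eq (fun p => ?_) h5).tsum_eq
    · rw [h6, ← (h j).Km_eq hk hs hpole]
      ring
    · have h7 := hsol j (n + p)
      rw [← foldyOperator] at h7
      rw [h7, incident_pos, mul_sub, Finset.mul_sum, neg_mul, lam_eq_taylorCoeff]
  rw [singleArray_eq_lowerToeplitz, congrFun hinv m]
  simp only [lowerToeplitz]
  rw [Finset.sum_comm, ← Finset.sum_sub_distrib]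
  refine Finset.sum_congr rfl fun n _ => ?_
  rw [hupper n, mul_sub, Finset.mul_sum]

/-- The diagonal block returns A itself and the others return the terms subtracted in
`IsFoldySolution.eq_singleArray_sub`. Since there are finitely many arrays, absolute convergence in
each block suffices for summation over all pairs. -/
theorem hasSum_blockMatrix (hk : 0 < k.im) (hadm : Admissible X)
    (hX : ∀ j, (OmegaPlus k θI (X j) ∩ OmegaMinus k (X j).s).Nonempty)
    (h : ∀ j, IsKernelFactorization k (X j).a (X j).s (Kp j) (Km j))
    (hA : ∀ j, ZTransformConverges k θI (X j) (A j)) (hsol : IsFoldySolution k θI X A)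
    (j : Fin J) (m : ℕ) :
    HasSum (fun v : Fin J × ℕ => blockMatrix k X Kp (j, m) v * A v.1 v.2)
      (singleArray k θI (X j) (Kp j) (Km j) m) := by
  set T : Fin J → ℂ := fun l => if l = j then A j m
    else lowerToeplitz (lam (Kp j)) (interactionSum k (X j) (X l) (Kp j) (A l)) m with hT
  have hrow : ∀ l, HasSum (fun q => blockMatrix k X Kp (j, m) (l, q) * A l q) (T l) := by
    intro l
    by_cases hl : l = j
    · subst hl
      simp only [hT, if_true]
      refine hasSum_of_forall_eq (fun q => ?_) (hasSum_ite_eq m (A l m))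
      have hblock : blockMatrix k X Kp (l, m) (l, q) = (1 : Matrix ℕ ℕ ℂ) m q := if_pos rfl
      rw [hblock, Matrix.one_apply]
      by_cases hq : q = m
      · simp [hq]
      · simp [hq, Ne.symm hq]
    · have hlj : j ≠ l := fun h => hl h.symm
      simp only [hT, if_neg hl]
      refine hasSum_of_forall_eq (fun q => ?_) (hasSum_interactionMatrix
        (hadm.summable_lam_mul_hankel hk hX h hA hlj) m)
      rw [blockMatrix, if_neg hlj]
  have hsum : Summable fun v : Fin J × ℕ => blockMatrix k X Kp (j, m) v * A v.1 v.2 := by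
    rw [← summable_norm_iff]
    refine (summable_prod_of_nonneg fun _ => norm_nonneg _).2
      ⟨fun l => (hrow l).summable.norm, Summable.of_finite⟩
  have h1 := hsum.hasSum.prod_fiberwise hrow
  have h2 := h1.unique (hasSum_fintype T)
  have h3 : ∑ l, T l = singleArray k θI (X j) (Kp j) (Km j) m := by
    rw [← Finset.add_sum_erase _ _ (Finset.mem_univ j)]
    have h4 : ∑ l ∈ Finset.univ.erase j, T l = ∑ l ∈ Finset.univ.erase j,
        lowerToeplitz (lam (Kp j)) (interactionSum k (X j) (X l) (Kp j) (A l)) m :=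
      Finset.sum_congr rfl fun l hl => by
        simp only [hT, if_neg (Finset.ne_of_mem_erase hl)]
    rw [h4]
    simp only [hT, if_true]
    rw [hsol.eq_singleArray_sub hk hadm hX h hA j m]
    ring
  rw [← h3, ← h2]
  exact hsum.hasSum

end

end FoldyArrays

theorem mainTheorem1 (k : ℂ) (hk : 0 < k.im) :
    -- the kernel is zero-free for small scatterers
    (∀ s : ℝ, 0 < s → ∃ ε : ℝ, 0 < ε ∧ ∀ a : ℝ, 0 < a → a < ε →
      FoldyArrays.KernelZeroFree k a s) ∧
    -- factorization of a zero-free kernel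
    (∀ a s : ℝ, 0 < a → 0 < s → FoldyArrays.KernelZeroFree k a s →
      (∃ Kp Km : ℂ → ℂ, FoldyArrays.IsKernelFactorization k a s Kp Km) ∧
      ∀ Kp Km : ℂ → ℂ, FoldyArrays.IsKernelFactorization k a s Kp Km →
        DifferentiableOn ℂ Kp {z | ‖z‖ < Real.exp (k.im * s)} ∧
        (∀ z : ℂ, ‖z‖ < Real.exp (k.im * s) → Kp z ≠ 0) ∧
        DifferentiableOn ℂ Km (FoldyArrays.OmegaMinus k s) ∧
        (∀ z ∈ FoldyArrays.OmegaMinus k s, Km z ≠ 0) ∧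
        (∀ z : ℂ, z ≠ 0 → ‖z‖ < Real.exp (k.im * s) → Km z⁻¹ = Kp z) ∧
        (∀ z ∈ FoldyArrays.kernelAnnulus k s, FoldyArrays.kernel k a s z = Kp z * Km z)) ∧
    -- the Wiener–Hopf solution of the coupled systems
    (∀ (J : ℕ) (X : Fin J → FoldyArrays.SemiInfiniteArray) (θI : ℝ),
      FoldyArrays.Admissible X →
      (∀ j, (FoldyArrays.OmegaPlus k θI (X j) ∩ FoldyArrays.OmegaMinus k (X j).s).Nonempty) →
      (∀ j, FoldyArrays.KernelZeroFree k (X j).a (X j).s) →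
      ∀ Kp Km : Fin J → ℂ → ℂ,
      (∀ j, FoldyArrays.IsKernelFactorization k (X j).a (X j).s (Kp j) (Km j)) →
      -- `A₀` solves the system of each array alone
      (∀ j,
        FoldyArrays.ZTransformConverges k θI (X j)
          (FoldyArrays.singleArray k θI (X j) (Kp j) (Km j)) ∧
        FoldyArrays.IsFoldySolution k θI (fun _ : Fin 1 => X j)
          (fun _ => FoldyArrays.singleArray k θI (X j) (Kp j) (Km j))) ∧
      -- the series defining the interaction matrices converge absolutely
      (∀ j l, j ≠ l → ∀ m q : ℕ,
        Summable fun p : ℕ => FoldyArrays.interactionTerm k (X j) (X l) (Kp j) m q p) ∧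
      ∀ A : Fin J → ℕ → ℂ,
        (∀ j, FoldyArrays.ZTransformConverges k θI (X j) (A j)) →
        FoldyArrays.IsFoldySolution k θI X A →
        (∀ j l, j ≠ l → ∀ m : ℕ, Summable fun x : ℕ × ℕ =>
          FoldyArrays.interactionTerm k (X j) (X l) (Kp j) m x.1 x.2 * A l x.1) ∧
        (∀ j l, j ≠ l → ∀ m : ℕ, Summable fun q : ℕ =>
          FoldyArrays.interactionMatrix k (X j) (X l) (Kp j) m q * A l q) ∧
        (∀ j, ∀ m : ℕ, A j m = FoldyArrays.singleArray k θI (X j) (Kp j) (Km j) m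
          - ∑ l ∈ Finset.univ.erase j, ∑' q : ℕ, ∑' p : ℕ, ∑ n ∈ Finset.range (m + 1),
              FoldyArrays.lam (Kp j) (m - n) * FoldyArrays.lam (Kp j) p * A l q
                * FoldyArrays.hankel
                    (k * FoldyArrays.scattererDist (X j) (X l) (p + n) q)) ∧
        (∀ j, ∀ m : ℕ, A j m = FoldyArrays.singleArray k θI (X j) (Kp j) (Km j) m
          - ∑ l ∈ Finset.univ.erase j,
              ∑' q : ℕ, FoldyArrays.interactionMatrix k (X j) (X l) (Kp j) m q * A l q) ∧
        (∀ j, ∀ m : ℕ, HasSum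
          (fun v : Fin J × ℕ => FoldyArrays.blockMatrix k X Kp (j, m) v * A v.1 v.2)
          (FoldyArrays.singleArray k θI (X j) (Kp j) (Km j) m))) := by
  refine ⟨fun s hs => FoldyArrays.kernelZeroFree_of_small hk hs, fun a s _ hs hK =>
    ⟨FoldyArrays.exists_isKernelFactorization hk hs hK, fun Kp Km h =>
      ⟨h.differentiableOn_Kp hk hs, fun z hz => h.Kp_ne_zero hk hs hz,
        h.differentiableOn_Km hk hs, fun z hz => h.Km_ne_zero hk hs hz,
        fun z hz0 hz => h.Km_inv hk hs hz0 hz, fun z hz => h.kernel_eq_mul hk hs hz⟩⟩, ?_⟩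
  intro J X θI hadm hX _ Kp Km h
  refine ⟨fun j => ⟨FoldyArrays.zTransformConverges_singleArray hk (hadm.spacing_pos j) (h j),
    FoldyArrays.isFoldySolution_singleArray hk (hadm.spacing_pos j) (hX j) (h j)⟩,
    fun j l hjl m q => FoldyArrays.summable_interactionTerm hk (hadm.spacing_pos j) (h j)
      (add_pos (hadm.radius_pos j) (hadm.radius_pos l))
      (fun m n => (hadm.other_array j l hjl m n).le) m q, ?_⟩
  intro A hA hsol
  have hsum := fun (j l : Fin J) (hjl : j ≠ l) =>
    hadm.summable_lam_mul_hankel hk hX h hA hjl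
  refine ⟨fun j l hjl m => (FoldyArrays.hasSum_interactionTerm (hsum j l hjl) m).summable,
    fun j l hjl m => (FoldyArrays.hasSum_interactionMatrix (hsum j l hjl) m).summable,
    fun j m => ?_, fun j m => ?_,
    fun j m => FoldyArrays.hasSum_blockMatrix hk hadm hX h hA hsol j m⟩
  · rw [hsol.eq_singleArray_sub hk hadm hX h hA j m]
    congr 1
    refine Finset.sum_congr rfl fun l hl => ?_
    have h1 := FoldyArrays.hasSum_interactionTerm (hsum j l (Finset.ne_of_mem_erase hl).symm) m
    rw [← h1.tsum_eq, h1.summable.tsum_prod]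
    refine tsum_congr fun q => tsum_congr fun p => ?_
    rw [FoldyArrays.interactionTerm, Finset.sum_mul]
    exact Finset.sum_congr rfl fun n _ => by ring
  · rw [hsol.eq_singleArray_sub hk hadm hX h hA j m]
    congr 1
    refine Finset.sum_congr rfl fun l hl => ?_
    exact (FoldyArrays.hasSum_interactionMatrix
      (hsum j l (Finset.ne_of_mem_erase hl).symm) m).tsum_eq.symm
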